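/- **Onsager reciprocity relation at lowest order for a tunnelling junction.** Let $d\ge 3$. Consider two reservoirs $r=I,II$ of free spinless fermions in $\mathbb R^d$, with one-particle space $L^2(\mathbb R^d)$, one-particle energy $-\Delta$ (units $\hbar=1$, mass $\tfrac12$), and particle number as the only conservation law. Their field algebra is the CAR algebra $\mathcal F$ generated by annihilation operators $a(f,r)$, $f\in L^2(\mathbb R^d)$, where operators of different reservoirs anticommute. The free dynamics $\alpha^r_t$ and the gauge transformations $\varphi^r_s$ of reservoir $r$ act by $a(f,r)\mapsto a(e^{-it\Delta}f,r)$ and $a(f,r)\mapsto a(e^{is}f,r)$, and trivially on the other reservoir; $\alpha^0_t=\alpha^I_t\circ\alpha^{II}_t$. For $\beta^r>0$, $\mu^r\in\mathbb R$ let $\omega^0$ be the state in which the uncoupled reservoirs are in equilibrium at inverse temperatures $\beta^r$ and chemical potentials $\mu^r$, i.e. the gauge-invariant quasi-free state with $$\omega^0(a^*(f,r)a(g,s))=\delta_{rs}\,\big\langle g,(e^{\beta^r(-\Delta-\mu^r)}+1)^{-1}f\big\rangle .$$ For $N\ge1$ let $$W_N=\int dX\,dY\;a^*(X_1)\cdots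 a^*(X_N)\,w_N(X,Y)\,a(Y_1)\cdots a(Y_N),\qquad X_j=(x_j,r_j),\ Y_j=(y_j,r_j'),$$ be selfadjoint, where every component of the kernel $w_N$ (for fixed reservoir labels) is in $L^2(\mathbb R^{2dN})$ and has a finite norm $$\|f\|'_M=2^{-3M/2}\Big\langle f,\prod_{k=1}^M(-\partial_k^2+x_k^2+1)^3f\Big\rangle^{1/2},\qquad M=2dN,$$ the quadratic form being understood in the basis of Hermite functions. Assume also that $s\mapsto\alpha^I_s(W_N)$ is norm-differentiable at $s=0$ and that its derivative $i[H\otimes 1,W_N]$ is an operator of the same form with a kernel of finite norm. Put $W=g\sum_{N\ge1}\xi^NW_N$, and let $\alpha_t$ be the dynamics perturbed by $W$. The observables of particle gain and energy gain of reservoir $I$ per unit time are $-\frac{d}{ds}\varphi^I_s(W)|_{s=0}=-i[N\otimes1,W]$ and $-\frac{d}{ds}\alpha^I_s(W)|_{s=0}=-i[H\otimes1,W]$. The particle current $\mathcal J$ and the energy current $\mathcal P$ are their expectation values in $\omega_{\rm stat}=\lim_{t\to\infty}\omega^0\circ\alpha_t$. Let $\mathcal J_{k,l}$ and $\mathcal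 P_{k,l}$ be the terms of order $g^k\xi^l$ of $\mathcal J$ and $\mathcal P$, i.e. the limits as $t\to\infty$ of the terms of this order which one obtains from the Dyson series $$\alpha^0_{-t}\alpha_t(a)=\sum_{m\ge0}i^m\int_{t>t_m>\dots>t_1>0}dt_1\cdots dt_m\,[W(t_m),\dots[W(t_1),a]\dots],\qquad W(t)=\alpha^0_{-t}(W).$$ Then for $k=l=2$ these limits exist for all $\beta^I,\beta^{II}>0$ and $\mu^I,\mu^{II}\in\mathbb R$. Regard $\mathcal J_{2,2}$ and $\mathcal P_{2,2}$ as functions of $\beta,\nu,\Delta\beta,\Delta\nu$, where $$\beta=\beta^I,\qquad \nu=\beta^I\mu^I,\qquad \Delta\beta=\beta^I-\beta^{II},\qquad \Delta\nu=\beta^I\mu^I-\beta^{II}\mu^{II}.$$ For all $\beta>0$ and $\nu\in\mathbb R$ the following partial derivatives at $\Delta\beta=\Delta\nu=0$ exist and satisfy $$\frac{\partial\mathcal P_{2,2}}{\partial\Delta\nu}\Big|_{\Delta\beta=\Delta\nu=0}=-\frac{\partial\mathcal J_{2,2}}{\partial\Delta\beta}\Big|_{\Delta\beta=\Delta\nu=0},$$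 where the derivative in $\Delta\nu$ is taken at constant $\beta,\nu,\Delta\beta$ and the derivative in $\Delta\beta$ at constant $\beta,\nu,\Delta\nu$. -/

import Mathlib

open MeasureTheory Filter Topology
open scoped FourierTransform ENNReal ComplexOrder

noncomputable section

namespace FermiJunction

/-- The labels of the two reservoirs. -/
inductive Reservoir where
  | I
  | II
  deriving DecidableEq

/-- Physical space `ℝ^d` with its Euclidean norm. -/
abbrev Space (d : ℕ) : Type := EuclideanSpace ℝ (Fin d)

/-- The one-particle space `L²(ℝ^d)` of a spinless particle. -/
abbrev OneParticle (d : ℕ) : Type := Lp ℂ 2 (volume : Measure (Space d))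

open Classical in
/-- The class in `L²(ℝ^d)` of a square-integrable function (zero for any other function). -/
def toL2 {d : ℕ} (f : Space d → ℂ) : OneParticle d :=
  if h : MemLp f 2 (volume : Measure (Space d)) then h.toLp f else 0

/-- The function `m(-Δ)` of the one-particle energy `-Δ`, defined through the Fourier transform.
With Mathlib's convention `𝓕 f ξ = ∫ e^{-2πi⟨x,ξ⟩} f x dx` the momentum is `k = 2πξ`, so that
`-Δ` is multiplication by `|k|² = (2π‖ξ‖)²`. It is used for bounded continuous `m`. -/
def energyFunction {d : ℕ} (m : ℝ → ℂ) (f : OneParticle d) : OneParticle d :=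
  𝓕⁻ (toL2 fun ξ : Space d => m ((2 * Real.pi * ‖ξ‖) ^ 2) * (𝓕 f : OneParticle d) ξ)

/-- The free one-particle time evolution `e^{it(-Δ)}` (in units with `ħ = 1` and mass `1/2`). -/
def freeProp {d : ℕ} (t : ℝ) : OneParticle d → OneParticle d :=
  energyFunction fun e => Complex.exp (Complex.I * (t : ℂ) * (e : ℂ))

/-- The one-particle Fermi operator `(e^{β(-Δ-μ)} + 1)⁻¹`, i.e. multiplication by
`ρ(k) = 1 / (e^{β(|k|²-μ)} + 1)` in momentum space. -/
def fermiOp {d : ℕ} (β μ : ℝ) : OneParticle d → OneParticle d :=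
  energyFunction fun e => ((1 / (Real.exp (β * (e - μ)) + 1) : ℝ) : ℂ)

/-- `A` is the CAR algebra over `L²(ℝ^d) ⊕ L²(ℝ^d)`: the C*-algebra generated by the annihilation
operators `a(f, r)` of the two reservoirs, which depend antilinearly on `f` and satisfy the
canonical anticommutation relations. Operators of different reservoirs anticommute. -/
structure CARAlgebra (d : ℕ) (A : Type*) [CStarAlgebra A] where
  /-- The annihilation operator `a(f, r)`; the creation operator `a*(f, r)` is its adjoint. -/
  annih : Reservoir → OneParticle d →ₗ⋆[ℂ] A
  anticomm : ∀ r s f g, annih r f * annih s g + annih s g * annih r f = 0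
  anticomm_star : ∀ r s f g,
    annih r f * star (annih s g) + star (annih s g) * annih r f =
      if r = s then (inner ℂ f g : ℂ) • (1 : A) else 0
  generates : (StarAlgebra.adjoin ℂ {x : A | ∃ r f, x = annih r f}).topologicalClosure = ⊤

/-- `ω` is the gauge-invariant quasi-free state with one-particle density operator `T r` in
reservoir `r` and no correlation between the reservoirs:
`ω(a*(f_m) ⋯ a*(f_1) a(g_1) ⋯ a(g_n)) = δ_{mn} det(⟨g_j, T f_i⟩)`. -/
structure CARAlgebra.IsQuasiFreeState {d : ℕ} {A : Type*} [CStarAlgebra A] (C : CARAlgebra d A)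
    (T : Reservoir → OneParticle d → OneParticle d) (ω : A →L[ℂ] ℂ) : Prop where
  unit : ω 1 = 1
  nonneg : ∀ x : A, 0 ≤ ω (star x * x)
  gauge_invariant : ∀ (m n : ℕ), m ≠ n →
    ∀ (f : Fin m → Reservoir × OneParticle d) (g : Fin n → Reservoir × OneParticle d),
      ω (star (List.ofFn fun i => C.annih (f i).1 (f i).2).prod *
        (List.ofFn fun j => C.annih (g j).1 (g j).2).prod) = 0
  wick : ∀ (n : ℕ) (f g : Fin n → Reservoir × OneParticle d),
      ω (star (List.ofFn fun i => C.annih (f i).1 (f i).2).prod *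
        (List.ofFn fun j => C.annih (g j).1 (g j).2).prod) =
      Matrix.det (Matrix.of fun i j =>
        if (f i).1 = (g j).1 then (inner ℂ (g j).2 (T (f i).1 (f i).2) : ℂ) else 0)

/-- Two infinitely extended reservoirs of free spinless fermions in `ℝ^d`: the field algebra with
the free dynamics `α_t^r` and the gauge transformations `φ_s^r` (generated by the particle number)
of each reservoir, and the states `ω⁰ = ω_{β^I,μ^I} ⊗ ω_{β^II,μ^II}` in which the uncoupled
reservoirs are in thermal equilibrium. The dynamics, the gauge transformations and the states are
determined by the values prescribed here on the generators. -/
structure FreeReservoirs (d : ℕ) (A : Type*) [CStarAlgebra A] extends CARAlgebra d A where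
  evol : Reservoir → ℝ → (A →⋆ₐ[ℂ] A)
  evol_annih : ∀ r t s f, evol r t (annih s f) = annih s (if s = r then freeProp t f else f)
  gauge : Reservoir → ℝ → (A →⋆ₐ[ℂ] A)
  gauge_annih : ∀ r t s f, gauge r t (annih s f) =
    annih s (if s = r then Complex.exp (Complex.I * (t : ℂ)) • f else f)
  equilibrium : (β μ : Reservoir → ℝ) → (A →L[ℂ] ℂ)
  equilibrium_spec : ∀ β μ : Reservoir → ℝ, (∀ r, 0 < β r) →
    toCARAlgebra.IsQuasiFreeState (fun r => fermiOp (β r) (μ r)) (equilibrium β μ)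

/-- The Hermite function `φ_q(x) = (-1)^q (2^q q!)^{-1/2} π^{-1/4} e^{x²/2} (d/dx)^q e^{-x²}`. -/
def hermiteFun (q : ℕ) (x : ℝ) : ℝ :=
  (-1) ^ q / (Real.sqrt (2 ^ q * (q.factorial : ℝ)) * Real.pi ^ (1 / 4 : ℝ)) *
    Real.exp (x ^ 2 / 2) * iteratedDeriv q (fun y : ℝ => Real.exp (-y ^ 2)) x

/-- The Hermite function of `d` variables with multi-index `q`. -/
def hermiteFunD {d : ℕ} (q : Fin d → ℕ) (x : Space d) : ℝ := ∏ i, hermiteFun (q i) (x i)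

/-- An `N`-body kernel `w_N((x, r), (y, r'))`, where `x, y ∈ (ℝ^d)^N` are positions and
`r, r'` the reservoirs of the `N` created and the `N` annihilated particles; the arguments are taken
in the order `r, r', x, y`. -/
abbrev Kernel (d N : ℕ) : Type :=
  (Fin N → Reservoir) → (Fin N → Reservoir) → (Fin N → Space d) → (Fin N → Space d) → ℂ

/-- The Hermite coefficients of the components of an `N`-body kernel. -/
def Kernel.coeff {d N : ℕ} (w : Kernel d N) (r r' : Fin N → Reservoir)
    (q q' : Fin N → Fin d → ℕ) : ℂ :=
  ∫ z : (Fin N → Space d) × (Fin N → Space d),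
    w r r' z.1 z.2 * ((∏ j, hermiteFunD (q j) (z.1 j) * hermiteFunD (q' j) (z.2 j) : ℝ) : ℂ)

/-- All components `f` of the kernel, which are functions on `ℝ^M` with `M = 2dN`, are in
`L²(ℝ^M)` and have a finite weighted Sobolev norm
`2^{-3M/2} ⟨f, ∏_k (-∂_k² + x_k² + 1)³ f⟩^{1/2}`. Since `-∂² + x² + 1` has the Hermite functions
`φ_q` as eigenfunctions, with eigenvalues `2(q + 1)`, the square of this norm is the sum below. -/
def Kernel.HasFiniteNorm {d N : ℕ} (w : Kernel d N) : Prop :=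
  ∀ r r' : Fin N → Reservoir,
    MemLp (fun z : (Fin N → Space d) × (Fin N → Space d) => w r r' z.1 z.2) 2 volume ∧
    Summable fun Q : (Fin N → Fin d → ℕ) × (Fin N → Fin d → ℕ) =>
      (∏ j, ∏ i, ((Q.1 j i : ℝ) + 1) ^ 3 * ((Q.2 j i : ℝ) + 1) ^ 3) *
        ‖w.coeff r r' Q.1 Q.2‖ ^ 2

/-- The operator `∫ dX dY a*(X_1) ⋯ a*(X_N) w(X, Y) a(Y_1) ⋯ a(Y_N)`, with `X_j = (x_j, r_j)`,
`Y_j = (y_j, r'_j)`, written in the basis of Hermite functions. For kernels of finite norm the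
series converges absolutely in norm. -/
def CARAlgebra.quantize {d : ℕ} {A : Type*} [CStarAlgebra A] (C : CARAlgebra d A) {N : ℕ}
    (w : Kernel d N) : A :=
  ∑' Q : (Fin N → Reservoir × (Fin d → ℕ)) × (Fin N → Reservoir × (Fin d → ℕ)),
    w.coeff (fun j => (Q.1 j).1) (fun j => (Q.2 j).1) (fun j => (Q.1 j).2) (fun j => (Q.2 j).2) •
      ((List.ofFn fun j =>
          star (C.annih (Q.1 j).1 (toL2 fun x => (hermiteFunD (Q.1 j).2 x : ℂ)))).prod *
        (List.ofFn fun j =>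
          C.annih (Q.2 j).1 (toL2 fun x => (hermiteFunD (Q.2 j).2 x : ℂ))).prod)

namespace FreeReservoirs

/-- The free dynamics `α_t⁰` of the two uncoupled reservoirs. -/
def freeEvol {d : ℕ} {A : Type*} [CStarAlgebra A] (S : FreeReservoirs d A) (t : ℝ) : A →⋆ₐ[ℂ] A :=
  (S.evol Reservoir.I t).comp (S.evol Reservoir.II t)

/-- The coefficient of order `g^m ξ^l` in the Dyson series
`∑_m i^m ∫_{t > t_m > ⋯ > t_1 > 0} [W(t_m), ⋯ [W(t_1), a] ⋯ ]` of `α_{-t}⁰(α_t(a))`, where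
`W(t) = α_{-t}⁰(W)` and `W = g ∑_{N ≥ 1} ξ^N W_N`. -/
def dyson {d : ℕ} {A : Type*} [CStarAlgebra A] (S : FreeReservoirs d A) (W : ℕ → A) :
    ℕ → ℕ → ℝ → A → A
  | 0, l, _, a => if l = 0 then a else 0
  | m + 1, l, t, a => ∑ N ∈ Finset.Icc 1 l, Complex.I •
      ∫ s in (0 : ℝ)..t,
        (S.freeEvol (-s) (W N) * dyson S W m (l - N) s a
          - dyson S W m (l - N) s a * S.freeEvol (-s) (W N))

/-- The coefficient of order `g^k ξ^l` in the Dyson series of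
`ω⁰(α_t(O)) = ω⁰(α_{-t}⁰(α_t(O)))`, where the observable is `O = g ∑_{N ≥ 1} ξ^N O_N`. -/
def expectationTerm {d : ℕ} {A : Type*} [CStarAlgebra A] (S : FreeReservoirs d A) (W O : ℕ → A)
    (k l : ℕ) (β μ : Reservoir → ℝ) (t : ℝ) : ℂ :=
  match k with
  | 0 => 0
  | m + 1 => ∑ N ∈ Finset.Icc 1 l, S.equilibrium β μ (S.dyson W m (l - N) t (O N))

/-- The rate of gain of particles of reservoir `I` due to the interaction `V`,
`-(d/ds) φ_s^I(V)|_{s=0} = -i[N ⊗ 1, V]`. -/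
def particleFlux {d : ℕ} {A : Type*} [CStarAlgebra A] (S : FreeReservoirs d A) (V : A) : A :=
  -deriv (fun s : ℝ => S.gauge Reservoir.I s V) 0

/-- The rate of gain of energy of reservoir `I` due to the interaction `V`,
`-(d/ds) α_s^I(V)|_{s=0} = -i[H ⊗ 1, V]`. -/
def energyFlux {d : ℕ} {A : Type*} [CStarAlgebra A] (S : FreeReservoirs d A) (V : A) : A :=
  -deriv (fun s : ℝ => S.evol Reservoir.I s V) 0

/-- The interaction `W_N` with kernel `w_N`, for all `N`. -/
def interaction {d : ℕ} {A : Type*} [CStarAlgebra A] (S : FreeReservoirs d A)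
    (w : ∀ N : ℕ, Kernel d N) (N : ℕ) : A :=
  S.quantize (w N)

/-- The term of order `g^k ξ^l` of the particle current into reservoir `I` at time `t`. -/
def particleCurrentAt {d : ℕ} {A : Type*} [CStarAlgebra A] (S : FreeReservoirs d A)
    (w : ∀ N : ℕ, Kernel d N) (k l : ℕ) (β μ : Reservoir → ℝ) (t : ℝ) : ℂ :=
  S.expectationTerm (S.interaction w) (fun N => S.particleFlux (S.interaction w N)) k l β μ t

/-- The term of order `g^k ξ^l` of the energy current into reservoir `I` at time `t`. -/
def energyCurrentAt {d : ℕ} {A : Type*} [CStarAlgebra A] (S : FreeReservoirs d A)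
    (w : ∀ N : ℕ, Kernel d N) (k l : ℕ) (β μ : Reservoir → ℝ) (t : ℝ) : ℂ :=
  S.expectationTerm (S.interaction w) (fun N => S.energyFlux (S.interaction w N)) k l β μ t

/-- The term `𝒥_{k,l}` of order `g^k ξ^l` of the particle current in the stationary state
`ω_stat = lim_{t → ∞} ω⁰ ∘ α_t`. -/
def particleCurrent {d : ℕ} {A : Type*} [CStarAlgebra A] (S : FreeReservoirs d A)
    (w : ∀ N : ℕ, Kernel d N) (k l : ℕ) (β μ : Reservoir → ℝ) : ℂ :=
  limUnder atTop (S.particleCurrentAt w k l β μ)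

/-- The term `𝒫_{k,l}` of order `g^k ξ^l` of the energy current in the stationary state
`ω_stat = lim_{t → ∞} ω⁰ ∘ α_t`. -/
def energyCurrent {d : ℕ} {A : Type*} [CStarAlgebra A] (S : FreeReservoirs d A)
    (w : ∀ N : ℕ, Kernel d N) (k l : ℕ) (β μ : Reservoir → ℝ) : ℂ :=
  limUnder atTop (S.energyCurrentAt w k l β μ)

end FreeReservoirs

/-- The inverse temperatures `β^I = β`, `β^II = β - Δβ`. -/
def invTemp (β Δβ : ℝ) : Reservoir → ℝ
  | Reservoir.I => β
  | Reservoir.II => β - Δβ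

/-- The chemical potentials with `β^I μ^I = ν` and `β^I μ^I - β^II μ^II = Δν`, where `β^I = β`
and `β^II = β - Δβ`. -/
def chemPot (β ν Δβ Δν : ℝ) : Reservoir → ℝ
  | Reservoir.I => ν / β
  | Reservoir.II => (ν - Δν) / (β - Δβ)

end FermiJunction

end

/-!
The term of order `g² ξ²` is `i ∫ ω⁰([W₁(t), O₁]) dt` over `t > 0`, where `O₁` is the flux belonging
to `W₁`. Both operators are second quantizations of nuclear one-body operators with Hermite matrices
that decay rapidly, so the expectation of the commutator is a sum of one-body traces
`tr (a P(t) o P(-t) m(-Δ))`, one for each reservoir, in which `m` is the Fermi function of that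
reservoir. For `d ≥ 3` these traces are integrable in time, because the Hermite functions disperse
like `t ^ (-d / 2)`; hence the currents converge to sums of a functional of the Fermi function of
reservoir `I` and one of the Fermi function of reservoir `II`, and only the latter varies with `Δβ`
and `Δν`.

Cyclicity of the trace turns the integral over `t > 0` into an integral over all times, which
defines a linear functional `L`: the particle current depends on the Fermi function `f` of
reservoir `II` through `L f`. In the energy current the observable is a time derivative, and an
integration by parts moves it onto the state as a factor `e`, which gives `L (e f)`. For
`f = σ (ν - β e)` the derivative of `f` with respect to `-β` and that of `e f` with respect to `ν`
are both `e σ' (ν - β e)`. As `β^II = β - Δβ` and `β^II μ^II = ν - Δν`, the two derivatives in the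
theorem are `-L (e σ')` and `L (e σ')`.
-/

noncomputable section

namespace FermiJunction

open scoped NNReal BoundedContinuousFunction

section MultiplicationOperators

variable {α X : Type*} [TopologicalSpace α] [MeasurableSpace α] [OpensMeasurableSpace α]
  [TopologicalSpace X] {μ : Measure α}

lemma memLp_comp_mul (q : C(α, X)) (φ : X →ᵇ ℂ) (f : Lp ℂ 2 μ) :
    MemLp (fun x => φ (q x) * f x) 2 μ :=
  (Lp.memLp f).of_le_mul (c := ‖φ‖)
    ((φ.continuous.comp q.continuous).aestronglyMeasurable.mul (Lp.memLp f).1)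
    (ae_of_all _ fun x => by
      rw [norm_mul]
      exact mul_le_mul_of_nonneg_right (φ.norm_coe_le_norm _) (norm_nonneg _))

/-- Multiplication by `φ ∘ q` as a bounded operator on `L²`. -/
def mulOp (μ : Measure α) (q : C(α, X)) (φ : X →ᵇ ℂ) : Lp ℂ 2 μ →L[ℂ] Lp ℂ 2 μ :=
  LinearMap.mkContinuous
    { toFun f := (memLp_comp_mul q φ f).toLp _
      map_add' f g := by
        rw [← MemLp.toLp_add, MemLp.toLp_eq_toLp_iff]
        filter_upwards [Lp.coeFn_add f g] with x hx
        simp only [hx, Pi.add_apply, mul_add]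
      map_smul' c f := by
        rw [← MemLp.toLp_const_smul, MemLp.toLp_eq_toLp_iff]
        filter_upwards [Lp.coeFn_smul c f] with x hx
        simp only [hx, Pi.smul_apply, smul_eq_mul, RingHom.id_apply, mul_left_comm] }
    ‖φ‖ fun f => by
      refine Lp.norm_le_mul_norm_of_ae_le_mul ?_
      filter_upwards [(memLp_comp_mul q φ f).coeFn_toLp] with x hx
      simp only [LinearMap.coe_mk, AddHom.coe_mk, hx, norm_mul]
      exact mul_le_mul_of_nonneg_right (φ.norm_coe_le_norm _) (norm_nonneg _)

lemma coeFn_mulOp (q : C(α, X)) (φ : X →ᵇ ℂ) (f : Lp ℂ 2 μ) :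
    mulOp μ q φ f =ᵐ[μ] fun x => φ (q x) * f x :=
  (memLp_comp_mul q φ f).coeFn_toLp

lemma mulOp_eq_iff {q : C(α, X)} {φ : X →ᵇ ℂ} {T : Lp ℂ 2 μ →L[ℂ] Lp ℂ 2 μ} :
    mulOp μ q φ = T ↔ ∀ f, (fun x => φ (q x) * f x) =ᵐ[μ] T f := by
  simp only [ContinuousLinearMap.ext_iff, Lp.ext_iff]
  exact forall_congr' fun f => ⟨(coeFn_mulOp q φ f).symm.trans, (coeFn_mulOp q φ f).trans⟩

/-- Multiplication operators by bounded continuous functions of `q` form a representation of the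
C*-algebra of these functions. -/
def mulOpHom (μ : Measure α) (q : C(α, X)) :
    (X →ᵇ ℂ) →⋆ₐ[ℂ] (Lp ℂ 2 μ →L[ℂ] Lp ℂ 2 μ) where
  toFun := mulOp μ q
  map_one' := mulOp_eq_iff.2 fun f => by simp
  map_zero' := mulOp_eq_iff.2 fun f => by simpa using! (Lp.coeFn_zero ℂ 2 μ).symm
  map_mul' φ ψ := mulOp_eq_iff.2 fun f => by
    rw [mul_apply_eq_comp]
    filter_upwards [coeFn_mulOp q φ (mulOp μ q ψ f), coeFn_mulOp q ψ f] with x h₁ h₂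
    rw [h₁, h₂, BoundedContinuousFunction.mul_apply, mul_assoc]
  map_add' φ ψ := mulOp_eq_iff.2 fun f => by
    rw [add_apply]
    filter_upwards [coeFn_mulOp q φ f, coeFn_mulOp q ψ f,
      Lp.coeFn_add (mulOp μ q φ f) (mulOp μ q ψ f)] with x h₁ h₂ h₃
    rw [h₃, Pi.add_apply, h₁, h₂, BoundedContinuousFunction.add_apply, add_mul]
  commutes' c := mulOp_eq_iff.2 fun f => by
    filter_upwards [Lp.coeFn_smul c f] with x hx
    simp [Algebra.algebraMap_eq_smul_one, hx]
  map_star' φ := by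
    rw [ContinuousLinearMap.star_eq_adjoint, ContinuousLinearMap.eq_adjoint_iff]
    intro f g
    rw [L2.inner_def, L2.inner_def]
    refine integral_congr_ae ?_
    filter_upwards [coeFn_mulOp q (star φ) f, coeFn_mulOp q φ g] with x h₁ h₂
    simp only [h₁, h₂, BoundedContinuousFunction.star_apply, RCLike.inner_apply, map_mul,
      RCLike.star_def, RCLike.conj_conj]
    ring

lemma inner_mulOp (q : C(α, X)) (φ : X →ᵇ ℂ) (f g : Lp ℂ 2 μ) :
    (inner ℂ f (mulOpHom μ q φ g) : ℂ) = ∫ x, φ (q x) * inner ℂ (f x) (g x) ∂μ := by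
  rw [L2.inner_def]
  refine integral_congr_ae ?_
  filter_upwards [coeFn_mulOp q φ g] with x hx
  exact (congrArg _ hx).trans (inner_smul_right ..)

lemma tendsto_mulOp_apply {ι : Type*} {l : Filter ι} [l.IsCountablyGenerated] (q : C(α, X))
    {φ : ι → X →ᵇ ℂ} {ψ : X →ᵇ ℂ} {C : ℝ} (hC : ∀ i, ‖φ i‖ ≤ C)
    (hφ : ∀ x, Tendsto (fun i => φ i x) l (𝓝 (ψ x))) (f : Lp ℂ 2 μ) :
    Tendsto (fun i => mulOpHom μ q (φ i) f) l (𝓝 (mulOpHom μ q ψ f)) := by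
  have norm_sq (i : ι) : ‖mulOpHom μ q (φ i) f - mulOpHom μ q ψ f‖ ^ 2 =
      ‖∫ x, (star (φ i - ψ) * (φ i - ψ)) (q x) * inner ℂ (f x) (f x) ∂μ‖ := by
    rw [← inner_mulOp, map_mul, map_star, ContinuousLinearMap.star_eq_adjoint,
      mul_apply_eq_comp, ContinuousLinearMap.adjoint_inner_right,
      inner_self_eq_norm_sq_to_K, map_sub, sub_apply]
    simp
  have bound (i : ι) (x : X) : ‖(star (φ i - ψ) * (φ i - ψ)) x‖ ≤ (C + ‖ψ‖) ^ 2 := by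
    have h : ‖(φ i - ψ) x‖ ≤ C + ‖ψ‖ :=
      ((φ i - ψ).norm_coe_le_norm x).trans
        ((norm_sub_le _ _).trans (add_le_add_left (hC i) _))
    simpa only [pow_two, BoundedContinuousFunction.mul_apply, BoundedContinuousFunction.star_apply,
      norm_mul, norm_star] using mul_self_le_mul_self (norm_nonneg _) h
  have lim : Tendsto (fun i => ∫ x, (star (φ i - ψ) * (φ i - ψ)) (q x) *
      inner ℂ (f x) (f x) ∂μ) l (𝓝 (∫ _, 0 ∂μ)) := by
    refine tendsto_integral_filter_of_dominated_convergence
      (fun x => (C + ‖ψ‖) ^ 2 * ‖(inner ℂ (f x) (f x) : ℂ)‖)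
      (Eventually.of_forall fun i =>
        (((star (φ i - ψ) * (φ i - ψ)).continuous.comp q.continuous).aestronglyMeasurable.mul
          (L2.integrable_inner f f).1))
      (Eventually.of_forall fun i => ae_of_all _ fun x => ?_)
      ((L2.integrable_inner f f).norm.const_mul _) (ae_of_all _ fun x => ?_)
    · rw [norm_mul]
      exact mul_le_mul_of_nonneg_right (bound i _) (norm_nonneg _)
    · have h : Tendsto (fun i => (φ i - ψ) (q x)) l (𝓝 0) := by
        simpa using (hφ (q x)).sub_const (ψ (q x))
      simpa using (h.star.mul h).mul_const (inner ℂ (f x) (f x) : ℂ)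
  rw [tendsto_iff_norm_sub_tendsto_zero]
  have h := (lim.norm.congr fun i => (norm_sq i).symm).sqrt
  simpa using h

end MultiplicationOperators

section Symbols

lemma hasDerivAt_of_norm_deriv_deriv_le {X E : Type*} [TopologicalSpace X]
    [NormedAddCommGroup E] [NormedSpace ℝ E] {F : ℝ → X →ᵇ E} {F' : X →ᵇ E} {f' f'' : ℝ → X → E}
    {t r C : ℝ} (hr : 0 < r) (hF' : ∀ x, f' t x = F' x)
    (h₁ : ∀ s ∈ Metric.ball t r, ∀ x, HasDerivAt (fun s => F s x) (f' s x) s)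
    (h₂ : ∀ s ∈ Metric.ball t r, ∀ x, HasDerivAt (fun s => f' s x) (f'' s x) s)
    (hC : ∀ s ∈ Metric.ball t r, ∀ x, ‖f'' s x‖ ≤ C) : HasDerivAt F F' t := by
  have ht : t ∈ Metric.ball t r := Metric.mem_ball_self hr
  have lipschitz (s) (hs : s ∈ Metric.ball t r) (x : X) : ‖f' s x - F' x‖ ≤ C * ‖s - t‖ := by
    rw [← hF']
    exact (convex_ball t r).norm_image_sub_le_of_norm_hasDerivWithin_le
      (fun u hu => (h₂ u hu x).hasDerivWithinAt) (fun u hu => hC u hu x) ht hs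
  have remainder (s) (hs : s ∈ Metric.ball t r) (x : X) :
      ‖F s x - F t x - (s - t) • F' x‖ ≤ C * ‖s - t‖ * ‖s - t‖ := by
    have hsub : Metric.closedBall t ‖s - t‖ ⊆ Metric.ball t r :=
      Metric.closedBall_subset_ball (by simpa [Real.dist_eq] using hs)
    have h := (convex_closedBall t ‖s - t‖).norm_image_sub_le_of_norm_hasDerivWithin_le
      (f := fun u => F u x - u • F' x) (C := C * ‖s - t‖)
      (fun u hu => ((h₁ u (hsub hu) x).sub
        ((hasDerivAt_id u).smul_const (F' x))).hasDerivWithinAt)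
      (fun u hu => ?_) (Metric.mem_closedBall_self (norm_nonneg _))
      (show s ∈ Metric.closedBall t ‖s - t‖ by simp [Real.dist_eq])
    · rwa [sub_sub_sub_comm, ← sub_smul] at h
    · rw [one_smul]
      exact (lipschitz u (hsub hu) x).trans (mul_le_mul_of_nonneg_left
        (by simpa [Real.dist_eq] using hu) ((norm_nonneg _).trans (hC t ht x)))
  rw [hasDerivAt_iff_isLittleO]
  refine Asymptotics.IsBigO.trans_isLittleO (g := fun s => ‖s - t‖ ^ 2)
    (Asymptotics.IsBigO.of_bound |C| ?_) (Asymptotics.isLittleO_pow_sub_sub t one_lt_two)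
  filter_upwards [Metric.ball_mem_nhds t hr] with s hs
  refine (BoundedContinuousFunction.norm_le (by positivity)).2 fun x => ?_
  refine (remainder s hs x).trans ?_
  rw [norm_pow, norm_norm, pow_two, mul_assoc]
  exact mul_le_mul_of_nonneg_right (le_abs_self C) (by positivity)

/-- Bounded continuous functions of the one-particle energy. -/
abbrev Symbol : Type := ℝ≥0 →ᵇ ℂ

/-- `e ↦ e^{ite}`, the symbol of the free one-particle time evolution. -/
def phase (t : ℝ) : Symbol :=
  BoundedContinuousFunction.ofNormedAddCommGroup
    (fun e => Complex.exp (Complex.I * (t : ℂ) * ((e : ℝ) : ℂ))) (by fun_prop) 1 fun e => by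
    simp [Complex.norm_exp]

lemma phase_apply (t : ℝ) (e : ℝ≥0) :
    phase t e = Complex.exp (Complex.I * (t : ℂ) * ((e : ℝ) : ℂ)) := rfl

lemma norm_phase_le (t : ℝ) : ‖phase t‖ ≤ 1 :=
  BoundedContinuousFunction.norm_ofNormedAddCommGroup_le _ zero_le_one _

lemma phase_zero : phase 0 = 1 := by
  ext e
  simp [phase_apply]

lemma phase_add (s t : ℝ) : phase (s + t) = phase s * phase t := by
  ext e
  simp only [phase_apply, BoundedContinuousFunction.mul_apply, ← Complex.exp_add]
  push_cast
  ring_nf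

lemma star_phase (t : ℝ) : star (phase t) = phase (-t) := by
  ext e
  simp [phase_apply, ← Complex.exp_conj]

lemma hasDerivAt_phase_mul {φ φ₁ φ₂ : Symbol} (h₁ : ∀ e : ℝ≥0, φ₁ e = ((e : ℝ) : ℂ) * φ e)
    (h₂ : ∀ e : ℝ≥0, φ₂ e = ((e : ℝ) : ℂ) * φ₁ e) (t : ℝ) :
    HasDerivAt (fun s => phase s * φ) (Complex.I • (phase t * φ₁)) t := by
  have pointwise (ψ ψ₁ : Symbol) (h : ∀ e : ℝ≥0, ψ₁ e = ((e : ℝ) : ℂ) * ψ e) (s : ℝ) (e : ℝ≥0) :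
      HasDerivAt (fun s => (phase s * ψ) e) ((Complex.I • (phase s * ψ₁)) e) s := by
    have h' := ((Complex.ofRealCLM.hasDerivAt (x := s)).const_mul Complex.I).mul_const
      ((e : ℝ) : ℂ) |>.cexp.mul_const (ψ e)
    convert! h' using 1
    simp only [BoundedContinuousFunction.smul_apply, BoundedContinuousFunction.mul_apply,
      phase_apply, smul_eq_mul, h, Complex.ofRealCLM_apply, Complex.ofReal_one]
    ring
  refine hasDerivAt_of_norm_deriv_deriv_le zero_lt_one (fun x => rfl)
    (f' := fun s e => (Complex.I • (phase s * φ₁)) e)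
    (f'' := fun s e => (Complex.I • Complex.I • (phase s * φ₂)) e) (C := ‖φ₂‖)
    (fun s _ => pointwise φ φ₁ h₁ s) (fun s _ e => ((pointwise φ₁ φ₂ h₂ s e).const_smul Complex.I))
    fun s _ e => (BoundedContinuousFunction.norm_coe_le_norm _ e).trans ?_
  rw [norm_smul, norm_smul, Complex.norm_I, one_mul, one_mul]
  exact (norm_mul_le _ _).trans (mul_le_of_le_one_left (norm_nonneg _) (norm_phase_le s))

end Symbols

section EnergyCalculus

variable {d : ℕ}

/-- The one-particle energy `|k|²` at the momentum `k = 2πξ`. -/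
def dispersion (d : ℕ) : C(Space d, ℝ≥0) where
  toFun ξ := (2 * NNReal.pi * ‖ξ‖₊) ^ 2

/-- The bounded continuous functional calculus of the one-particle energy `-Δ`. -/
def energyOp : Symbol →⋆ₐ[ℂ] (OneParticle d →L[ℂ] OneParticle d) :=
  ((Lp.fourierTransformₗᵢ (Space d) ℂ).symm.conjStarAlgEquiv : _ →⋆ₐ[ℂ] _).comp
    (mulOpHom volume (dispersion d))

lemma energyOp_apply (φ : Symbol) (f : OneParticle d) :
    energyOp φ f = 𝓕⁻ (mulOpHom volume (dispersion d) φ (𝓕 f)) := rfl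

lemma energyFunction_eq_energyOp {m : ℝ → ℂ} {φ : Symbol} (h : ∀ e : ℝ≥0, m e = φ e)
    (f : OneParticle d) : energyFunction m f = energyOp φ f := by
  have hm : (fun ξ : Space d => m ((2 * Real.pi * ‖ξ‖) ^ 2) * (𝓕 f : OneParticle d) ξ) =
      fun ξ => φ (dispersion d ξ) * (𝓕 f : OneParticle d) ξ := by
    funext ξ
    rw [← h]
    rfl
  rw [energyFunction, toL2, hm, dif_pos (memLp_comp_mul _ φ _)]
  rfl

lemma norm_energyOp_le (φ : Symbol) : ‖(energyOp φ : OneParticle d →L[ℂ] OneParticle d)‖ ≤ ‖φ‖ :=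
  NonUnitalStarAlgHom.norm_apply_le _ φ

lemma commute_energyOp (φ ψ : Symbol) :
    Commute (energyOp φ : OneParticle d →L[ℂ] OneParticle d) (energyOp ψ) :=
  (Commute.all φ ψ).map energyOp

lemma tendsto_energyOp_apply {ι : Type*} {l : Filter ι} [l.IsCountablyGenerated]
    {φ : ι → Symbol} {ψ : Symbol} {C : ℝ} (hC : ∀ i, ‖φ i‖ ≤ C)
    (hφ : ∀ e, Tendsto (fun i => φ i e) l (𝓝 (ψ e))) (f : OneParticle d) :
    Tendsto (fun i => energyOp (φ i) f) l (𝓝 (energyOp ψ f)) :=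
  ((Lp.fourierTransformₗᵢ (Space d) ℂ).symm.continuous.tendsto _).comp
    (tendsto_mulOp_apply _ hC hφ (𝓕 f))

/-- The free one-particle time evolution `e^{it(-Δ)}` as a bounded operator. -/
def propagator (t : ℝ) : OneParticle d →L[ℂ] OneParticle d :=
  energyOp (phase t)

lemma freeProp_eq_propagator (t : ℝ) (f : OneParticle d) : freeProp t f = propagator t f :=
  energyFunction_eq_energyOp (fun _ => rfl) f

lemma propagator_zero : propagator 0 = (1 : OneParticle d →L[ℂ] OneParticle d) := by
  rw [propagator, phase_zero, map_one]

lemma propagator_add (s t : ℝ) :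
    propagator (s + t) = (propagator s * propagator t : OneParticle d →L[ℂ] OneParticle d) := by
  simp only [propagator, phase_add, map_mul]

lemma star_propagator (t : ℝ) :
    star (propagator t) = (propagator (-t) : OneParticle d →L[ℂ] OneParticle d) := by
  rw [propagator, ← map_star, star_phase, propagator]

lemma propagator_mul_star_propagator (t : ℝ) :
    propagator t * star (propagator t) = (1 : OneParticle d →L[ℂ] OneParticle d) := by
  rw [star_propagator, ← propagator_add, add_neg_cancel, propagator_zero]

lemma norm_propagator_le (t : ℝ) : ‖(propagator t : OneParticle d →L[ℂ] OneParticle d)‖ ≤ 1 :=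
  (norm_energyOp_le _).trans (norm_phase_le t)

lemma continuous_propagator_apply (f : OneParticle d) : Continuous fun t => propagator t f :=
  continuous_iff_continuousAt.2 fun t => tendsto_energyOp_apply norm_phase_le
    (fun e => Continuous.tendsto (by simp only [phase_apply]; fun_prop) t) f

end EnergyCalculus

section DispersiveEstimate

section Fourier

variable {V : Type*} [NormedAddCommGroup V] [InnerProductSpace ℝ V] [FiniteDimensional ℝ V]
  [MeasurableSpace V] [BorelSpace V] {f g G : V → ℂ}

lemma continuous_fourier (hf : Integrable f) : Continuous (𝓕 f : V → ℂ) :=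
  VectorFourier.fourierIntegral_continuous Real.continuous_fourierChar continuous_inner hf

lemma integral_fourier_mul (hf : Integrable f) (hg : Integrable g) :
    ∫ ξ, 𝓕 f ξ * g ξ = ∫ x, f x * 𝓕 g x := by
  simpa using! VectorFourier.integral_fourierIntegral_smul_eq_flip (L := innerₗ V)
    Real.continuous_fourierChar continuous_inner hf hg

lemma fourier_toLp_ae_eq (h₁ : Integrable f) (h₂ : MemLp f 2) :
    (𝓕 (h₂.toLp f) : Lp ℂ 2 (volume : Measure V)) =ᵐ[volume] (𝓕 f : V → ℂ) := by
  refine ae_eq_of_integral_contDiff_smul_eq ((Lp.memLp _).locallyIntegrable one_le_two)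
    (continuous_fourier h₁).locallyIntegrable fun φ hφ hφc => ?_
  have hc : HasCompactSupport (Complex.ofRealCLM ∘ φ) := hφc.comp_left rfl
  let Φ : SchwartzMap V ℂ := hc.toSchwartzMap (by fun_prop)
  have duality : Lp.toTemperedDistribution (𝓕 (h₂.toLp f)) Φ =
      Lp.toTemperedDistribution (h₂.toLp f) (𝓕 Φ) := by
    rw [← Lp.fourier_toTemperedDistribution_eq, TemperedDistribution.fourier_apply]
  rw [Lp.toTemperedDistribution_apply, Lp.toTemperedDistribution_apply] at duality
  calc ∫ x, φ x • (𝓕 (h₂.toLp f) : Lp ℂ 2 (volume : Measure V)) x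
      = ∫ x, (𝓕 Φ : SchwartzMap V ℂ) x • h₂.toLp f x := by rw [← duality]; rfl
    _ = ∫ x, 𝓕 (Φ : V → ℂ) x * f x := integral_congr_ae <| by
        filter_upwards [h₂.coeFn_toLp] with x hx
        rw [hx, SchwartzMap.fourier_coe, smul_eq_mul]
    _ = ∫ x, φ x • 𝓕 f x := integral_fourier_mul Φ.integrable h₁

lemma conj_fourier (f : V → ℂ) (ξ : V) :
    starRingEnd ℂ (𝓕 f ξ) = 𝓕 (fun x => starRingEnd ℂ (f (-x))) ξ := by
  rw [Real.fourier_eq', Real.fourier_eq', ← integral_conj, ← integral_neg_eq_self]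
  refine integral_congr_ae (ae_of_all _ fun x => ?_)
  simp [← Complex.exp_conj, Complex.conj_ofNat]

lemma norm_integral_mul_fourier_mul_conj_le (hG : Integrable G) {K : ℝ}
    (hK : ∀ x, ‖𝓕 G x‖ ≤ K) (hf : Integrable f) (hg : Integrable g) :
    ‖∫ ξ, G ξ * (𝓕 g ξ * starRingEnd ℂ (𝓕 f ξ))‖ ≤ K * (∫ x, ‖f x‖) * ∫ x, ‖g x‖ := by
  have hf' : Integrable fun x => starRingEnd ℂ (f (-x)) :=
    (Complex.conjLIE.integrable_comp_iff (φ := fun x => f (-x))).2 hf.comp_neg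
  have norm_f' : ∫ x, ‖starRingEnd ℂ (f (-x))‖ = ∫ x, ‖f x‖ := by
    simpa only [RCLike.norm_conj] using integral_neg_eq_self (fun x => ‖f x‖) volume
  have hfg := hg.integrable_convolution (ContinuousLinearMap.mul ℂ ℂ) hf'
  have hfg_norm := hg.norm.integrable_convolution (ContinuousLinearMap.mul ℝ ℝ) hf'.norm
  calc ‖∫ ξ, G ξ * (𝓕 g ξ * starRingEnd ℂ (𝓕 f ξ))‖
      = ‖∫ x, 𝓕 G x * (MeasureTheory.convolution g (fun x => starRingEnd ℂ (f (-x)))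
          (ContinuousLinearMap.mul ℂ ℂ) volume) x‖ := by
        rw [integral_fourier_mul hG hfg]
        simp only [Real.fourier_mul_convolution_eq hg hf', conj_fourier]
    _ ≤ ∫ x, K * (MeasureTheory.convolution (‖g ·‖) (fun x => ‖starRingEnd ℂ (f (-x))‖)
          (ContinuousLinearMap.mul ℝ ℝ) volume) x := by
        refine norm_integral_le_of_norm_le (hfg_norm.const_mul K) (ae_of_all _ fun x => ?_)
        rw [norm_mul]
        refine mul_le_mul (hK x) ((norm_integral_le_integral_norm _).trans_eq ?_)
          (norm_nonneg _) ((norm_nonneg _).trans (hK x))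
        simp only [ContinuousLinearMap.mul_apply', norm_mul, convolution]
    _ = K * (∫ x, ‖f x‖) * ∫ x, ‖g x‖ := by
        rw [integral_const_mul, integral_convolution _ hg.norm hf'.norm, norm_f',
          ContinuousLinearMap.mul_apply', mul_comm (∫ x, ‖g x‖), mul_assoc]

lemma norm_fourier_gaussian_le {b : ℂ} (hb : 0 < b.re) (x : V) :
    ‖𝓕 (fun ξ : V => Complex.exp (-b * ‖ξ‖ ^ 2)) x‖ ≤
      (Real.pi / ‖b‖) ^ ((Module.finrank ℝ V : ℝ) / 2) := by
  rw [fourier_gaussian_innerProductSpace hb, norm_mul]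
  have prefactor : ‖(Real.pi / b : ℂ) ^ (Module.finrank ℝ V / 2 : ℂ)‖ =
      (Real.pi / ‖b‖) ^ ((Module.finrank ℝ V : ℝ) / 2) := by
    rw [← Complex.ofReal_natCast, ← Complex.ofReal_ofNat, ← Complex.ofReal_div,
      Complex.norm_cpow_real, norm_div, Complex.norm_real, Real.norm_of_nonneg Real.pi_pos.le]
  have exponential : ‖Complex.exp (-Real.pi ^ 2 * ‖x‖ ^ 2 / b)‖ ≤ 1 := by
    rw [Complex.norm_exp, Real.exp_le_one_iff,
      show (-(Real.pi : ℂ) ^ 2 * ‖x‖ ^ 2 / b) =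
        ((-(Real.pi ^ 2 * ‖x‖ ^ 2) : ℝ) : ℂ) * b⁻¹ by push_cast; ring,
      Complex.re_ofReal_mul, Complex.inv_re, neg_mul, neg_nonpos]
    have := div_nonneg hb.le (Complex.normSq_nonneg b)
    positivity
  rw [prefactor]
  exact mul_le_of_le_one_right (by positivity) exponential

end Fourier

variable {d : ℕ} {f g : Space d → ℂ}

/-- `e ↦ e^{-εe}`, a regularization of symbols at large energy. -/
def damping (ε : ℝ≥0) : Symbol :=
  BoundedContinuousFunction.ofNormedAddCommGroup
    (fun e => Complex.exp (-(ε : ℝ) * ((e : ℝ) : ℂ))) (by fun_prop) 1 fun e => by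
    rw [Complex.norm_exp]
    simpa using by positivity

lemma damping_apply (ε e : ℝ≥0) : damping ε e = Complex.exp (-(ε : ℝ) * ((e : ℝ) : ℂ)) := rfl

lemma tendsto_damping_mul_propagator (t : ℝ) (f : OneParticle d) :
    Tendsto (fun ε => energyOp (damping ε * phase t) f) (𝓝[>] 0) (𝓝 (propagator t f)) := by
  refine tendsto_energyOp_apply (C := 1) (fun ε => (norm_mul_le _ _).trans ?_) (fun e => ?_) f
  · exact mul_le_one₀ (BoundedContinuousFunction.norm_ofNormedAddCommGroup_le _ zero_le_one _)
      (norm_nonneg _) (norm_phase_le t)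
  · refine tendsto_nhdsWithin_of_tendsto_nhds (Continuous.tendsto' ?_ _ _ ?_)
    · simp only [BoundedContinuousFunction.mul_apply, damping_apply]
      fun_prop
    · simp [damping_apply]

lemma inner_energyOp_toL2 (hf : Integrable f) (hf₂ : MemLp f 2) (hg : Integrable g)
    (hg₂ : MemLp g 2) (φ : Symbol) :
    (inner ℂ (toL2 f) (energyOp φ (toL2 g)) : ℂ) =
      ∫ ξ, φ (dispersion d ξ) * (𝓕 g ξ * starRingEnd ℂ (𝓕 f ξ)) := by
  rw [toL2, toL2, dif_pos hf₂, dif_pos hg₂, ← Lp.inner_fourier_eq, energyOp_apply,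
    FourierTransform.fourier_fourierInv_eq, inner_mulOp]
  refine integral_congr_ae ?_
  filter_upwards [fourier_toLp_ae_eq hf hf₂, fourier_toLp_ae_eq hg hg₂] with ξ h₁ h₂
  rw [h₁, h₂, RCLike.inner_apply]

lemma norm_inner_damping_mul_phase_le (hf : Integrable f) (hf₂ : MemLp f 2) (hg : Integrable g)
    (hg₂ : MemLp g 2) {t : ℝ} (ht : t ≠ 0) {ε : ℝ≥0} (hε : 0 < ε) :
    ‖(inner ℂ (toL2 f) (energyOp (damping ε * phase t) (toL2 g)) : ℂ)‖ ≤
      (4 * Real.pi * |t|)⁻¹ ^ ((d : ℝ) / 2) * (∫ x, ‖f x‖) * ∫ x, ‖g x‖ := by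
  let b : ℂ := ((4 * Real.pi ^ 2 : ℝ) : ℂ) * ((ε : ℝ) - Complex.I * t)
  have re_pos : 0 < b.re := by
    rw [Complex.re_ofReal_mul]
    have : (0 : ℝ) < ε := hε
    simpa using by positivity
  have le_norm : 4 * Real.pi ^ 2 * |t| ≤ ‖b‖ := by
    refine le_trans (le_of_eq ?_) (Complex.abs_im_le_norm b)
    rw [Complex.im_ofReal_mul, abs_mul, abs_of_pos (by positivity : 0 < 4 * Real.pi ^ 2)]
    simp
  have symbol_eq (ξ : Space d) :
      (damping ε * phase t) (dispersion d ξ) = Complex.exp (-b * ‖ξ‖ ^ 2) := by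
    rw [BoundedContinuousFunction.mul_apply, damping_apply, phase_apply, ← Complex.exp_add]
    simp only [dispersion, ContinuousMap.coe_mk, b]
    push_cast [NNReal.coe_real_pi]
    ring_nf
  have hG : Integrable fun ξ : Space d => Complex.exp (-b * ‖ξ‖ ^ 2) := by
    simpa using GaussianFourier.integrable_cexp_neg_mul_sq_norm_add re_pos 0 (0 : Space d)
  rw [inner_energyOp_toL2 hf hf₂ hg hg₂]
  simp only [symbol_eq]
  refine norm_integral_mul_fourier_mul_conj_le hG (fun x => ?_) hf hg
  refine (norm_fourier_gaussian_le re_pos x).trans ?_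
  rw [finrank_euclideanSpace_fin]
  have : 0 < |t| := abs_pos.2 ht
  gcongr
  rw [div_le_iff₀ (lt_of_lt_of_le (by positivity) le_norm), ← div_eq_inv_mul,
    le_div_iff₀ (by positivity)]
  linarith

lemma norm_inner_propagator_le (hf : Integrable f) (hf₂ : MemLp f 2) (hg : Integrable g)
    (hg₂ : MemLp g 2) {t : ℝ} (ht : t ≠ 0) :
    ‖(inner ℂ (toL2 f) (propagator t (toL2 g)) : ℂ)‖ ≤
      (4 * Real.pi * |t|)⁻¹ ^ ((d : ℝ) / 2) * (∫ x, ‖f x‖) * ∫ x, ‖g x‖ :=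
  le_of_tendsto
    (Tendsto.norm (Tendsto.inner tendsto_const_nhds (tendsto_damping_mul_propagator t (toL2 g))))
    (eventually_mem_nhdsWithin.mono fun _ hε =>
      norm_inner_damping_mul_phase_le hf hf₂ hg hg₂ ht hε)

end DispersiveEstimate

section HermiteFunctions

variable {d : ℕ}

open Polynomial in
/-- The polynomial `p` with `(d/dx)^q e^{-x²} = p(x) e^{-x²}`, i.e. `(-1)^q` times the Hermite
polynomial in the convention of physics. -/
def gaussPoly : ℕ → ℝ[X]
  | 0 => 1
  | q + 1 => derivative (gaussPoly q) - C 2 * X * gaussPoly q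

lemma hasDerivAt_eval_mul_gaussian (P : Polynomial ℝ) (x : ℝ) :
    HasDerivAt (fun y => P.eval y * Real.exp (-y ^ 2))
      ((P.derivative - Polynomial.C 2 * Polynomial.X * P).eval x * Real.exp (-x ^ 2)) x := by
  have hgauss : HasDerivAt (fun y : ℝ => Real.exp (-y ^ 2)) (Real.exp (-x ^ 2) * (-(2 * x))) x := by
    simpa using ((hasDerivAt_pow 2 x).fun_neg).exp
  refine ((P.hasDerivAt x).mul hgauss).congr_deriv ?_
  simp only [Polynomial.eval_sub, Polynomial.eval_mul, Polynomial.eval_C, Polynomial.eval_X]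
  ring

lemma iteratedDeriv_gaussian (q : ℕ) :
    iteratedDeriv q (fun y : ℝ => Real.exp (-y ^ 2)) =
      fun x => (gaussPoly q).eval x * Real.exp (-x ^ 2) := by
  induction q with
  | zero => simp [gaussPoly]
  | succ q ih =>
    rw [iteratedDeriv_succ, ih]
    funext x
    exact (hasDerivAt_eval_mul_gaussian _ x).deriv

lemma derivative_gaussPoly_succ (q : ℕ) :
    (gaussPoly (q + 1)).derivative = Polynomial.C (-2 * ((q : ℝ) + 1)) * gaussPoly q := by
  induction q with
  | zero => simp [gaussPoly]
  | succ q ih =>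
    rw [gaussPoly, Polynomial.derivative_sub, ih]
    simp only [Polynomial.derivative_mul, Polynomial.derivative_C, Polynomial.derivative_X, ih]
    rw [gaussPoly]
    push_cast
    simp only [map_mul, map_add, map_neg, map_one]
    ring

lemma integrable_eval_mul_gaussian (P : Polynomial ℝ) {b : ℝ} (hb : 0 < b) :
    Integrable fun x : ℝ => P.eval x * Real.exp (-b * x ^ 2) := by
  induction P using Polynomial.induction_on' with
  | add p q hp hq =>
    simpa only [Polynomial.eval_add, add_mul] using! hp.add hq
  | monomial n a =>
    have := (integrable_rpow_mul_exp_neg_mul_sq hb (s := (n : ℝ))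
      (by have : (0 : ℝ) ≤ n := n.cast_nonneg
          linarith)).const_mul a
    simpa only [Polynomial.eval_monomial, Real.rpow_natCast, mul_assoc] using this

lemma integrable_eval_mul_gaussian_one (P : Polynomial ℝ) :
    Integrable fun x : ℝ => P.eval x * Real.exp (-x ^ 2) := by
  simpa using integrable_eval_mul_gaussian P one_pos

/-- The integral of a polynomial with respect to the Gaussian weight. -/
def gaussInt (P : Polynomial ℝ) : ℝ := ∫ x : ℝ, P.eval x * Real.exp (-x ^ 2)

lemma gaussInt_add (P Q : Polynomial ℝ) : gaussInt (P + Q) = gaussInt P + gaussInt Q := by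
  rw [gaussInt, gaussInt, gaussInt, ← integral_add (integrable_eval_mul_gaussian_one P)
    (integrable_eval_mul_gaussian_one Q)]
  simp only [Polynomial.eval_add, add_mul]

lemma gaussInt_C_mul (a : ℝ) (P : Polynomial ℝ) :
    gaussInt (Polynomial.C a * P) = a * gaussInt P := by
  rw [gaussInt, gaussInt, ← integral_const_mul]
  simp only [Polynomial.eval_mul, Polynomial.eval_C, mul_assoc]

lemma gaussInt_mono {P Q : Polynomial ℝ} (h : ∀ x, P.eval x ≤ Q.eval x) :
    gaussInt P ≤ gaussInt Q :=
  integral_mono (integrable_eval_mul_gaussian_one P) (integrable_eval_mul_gaussian_one Q)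
    fun x => mul_le_mul_of_nonneg_right (h x) (Real.exp_pos _).le

lemma gaussInt_gaussPoly_sq_succ (q : ℕ) :
    gaussInt (gaussPoly (q + 1) ^ 2) = 2 * (q + 1) * gaussInt (gaussPoly q ^ 2) := by
  have hsplit : gaussInt (gaussPoly (q + 1) ^ 2) = ∫ x : ℝ, (gaussPoly (q + 1)).eval x *
      ((gaussPoly (q + 1)).eval x * Real.exp (-x ^ 2)) := by
    refine integral_congr_ae (ae_of_all _ fun x => ?_)
    simp only [Polynomial.eval_pow]
    ring
  have hparts := integral_mul_deriv_eq_deriv_mul_of_integrable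
    (u := fun x => (gaussPoly (q + 1)).eval x)
    (u' := fun x => (gaussPoly (q + 1)).derivative.eval x)
    (v := fun x => (gaussPoly q).eval x * Real.exp (-x ^ 2))
    (v' := fun x => (gaussPoly (q + 1)).eval x * Real.exp (-x ^ 2))
    (fun x _ => (gaussPoly (q + 1)).hasDerivAt x)
    (fun x _ => hasDerivAt_eval_mul_gaussian (gaussPoly q) x)
    (by simpa [Pi.mul_def, mul_assoc] using
      integrable_eval_mul_gaussian_one (gaussPoly (q + 1) * gaussPoly (q + 1)))
    (by simpa [Pi.mul_def, mul_assoc] using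
      integrable_eval_mul_gaussian_one ((gaussPoly (q + 1)).derivative * gaussPoly q))
    (by simpa [Pi.mul_def, mul_assoc] using
      integrable_eval_mul_gaussian_one (gaussPoly (q + 1) * gaussPoly q))
  rw [hsplit, hparts, derivative_gaussPoly_succ, gaussInt, ← integral_const_mul, ← integral_neg]
  refine integral_congr_ae (ae_of_all _ fun x => ?_)
  simp only [Polynomial.eval_mul, Polynomial.eval_C, Polynomial.eval_pow]
  ring

lemma gaussInt_gaussPoly_sq (q : ℕ) :
    gaussInt (gaussPoly q ^ 2) = 2 ^ q * (q.factorial : ℝ) * Real.sqrt Real.pi := by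
  induction q with
  | zero =>
    have := integral_gaussian 1
    simpa [gaussPoly, gaussInt] using this
  | succ q ih =>
    rw [gaussInt_gaussPoly_sq_succ, ih, Nat.factorial_succ]
    push_cast
    ring

lemma gaussInt_derivative_sq (q : ℕ) :
    gaussInt ((gaussPoly q).derivative ^ 2) = 2 * q * gaussInt (gaussPoly q ^ 2) := by
  cases q with
  | zero => simp [gaussPoly, gaussInt]
  | succ q =>
    rw [derivative_gaussPoly_succ, gaussInt_gaussPoly_sq_succ, mul_pow, ← Polynomial.C_pow,
      gaussInt_C_mul]
    push_cast
    ring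

lemma gaussInt_X_sq_mul_le (q : ℕ) :
    gaussInt (Polynomial.X ^ 2 * gaussPoly q ^ 2) ≤ (2 * q + 1) * gaussInt (gaussPoly q ^ 2) := by
  have hle : gaussInt (Polynomial.X ^ 2 * gaussPoly q ^ 2) ≤ gaussInt (Polynomial.C (1 / 2) *
      (gaussPoly (q + 1) ^ 2 + (gaussPoly q).derivative ^ 2)) := by
    refine gaussInt_mono fun x => ?_
    have heval : (gaussPoly (q + 1)).eval x = (gaussPoly q).derivative.eval x -
        2 * x * (gaussPoly q).eval x := by
      simp [gaussPoly]
    simp only [Polynomial.eval_mul, Polynomial.eval_add, Polynomial.eval_pow, Polynomial.eval_X,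
      Polynomial.eval_C, heval]
    nlinarith [sq_nonneg ((gaussPoly q).derivative.eval x - x * (gaussPoly q).eval x)]
  refine hle.trans (le_of_eq ?_)
  rw [gaussInt_C_mul, gaussInt_add, gaussInt_derivative_sq, gaussInt_gaussPoly_sq_succ]
  ring

lemma hermiteFun_eq (q : ℕ) (x : ℝ) :
    hermiteFun q x = (-1) ^ q / (Real.sqrt (2 ^ q * (q.factorial : ℝ)) * Real.pi ^ (1 / 4 : ℝ)) *
      ((gaussPoly q).eval x * Real.exp (-(1 / 2) * x ^ 2)) := by
  rw [hermiteFun, iteratedDeriv_gaussian, mul_assoc]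
  congr 1
  rw [show -(1 / 2) * x ^ 2 = x ^ 2 / 2 + -x ^ 2 by ring, Real.exp_add]
  ring

lemma integrable_hermiteFun (q : ℕ) : Integrable (hermiteFun q) := by
  rw [show hermiteFun q = _ from funext (hermiteFun_eq q)]
  exact (integrable_eval_mul_gaussian _ (by norm_num)).const_mul _

lemma hermiteFun_sq (q : ℕ) (x : ℝ) : hermiteFun q x ^ 2 =
    (gaussInt (gaussPoly q ^ 2))⁻¹ * ((gaussPoly q ^ 2).eval x * Real.exp (-x ^ 2)) := by
  rw [hermiteFun_eq, gaussInt_gaussPoly_sq, mul_pow, mul_pow, div_pow, mul_pow, ← pow_mul,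
    mul_comm q 2, pow_mul, neg_one_sq, one_pow, Real.sq_sqrt (by positivity), ← Real.exp_nat_mul,
    Polynomial.eval_pow, ← Real.rpow_natCast (Real.pi ^ (1 / 4 : ℝ)),
    ← Real.rpow_mul Real.pi_pos.le, Real.sqrt_eq_rpow, one_div]
  norm_num
  ring_nf
  simp

lemma gaussInt_gaussPoly_sq_pos (q : ℕ) : 0 < gaussInt (gaussPoly q ^ 2) := by
  rw [gaussInt_gaussPoly_sq]
  have := Real.pi_pos
  positivity

lemma integrable_hermiteFun_sq (q : ℕ) : Integrable fun x => hermiteFun q x ^ 2 := by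
  simp only [hermiteFun_sq]
  exact (integrable_eval_mul_gaussian_one _).const_mul _

lemma integral_hermiteFun_sq (q : ℕ) : ∫ x, hermiteFun q x ^ 2 = 1 := by
  simp only [hermiteFun_sq]
  rw [integral_const_mul]
  exact inv_mul_cancel₀ (gaussInt_gaussPoly_sq_pos q).ne'

lemma abs_hermiteFun_le (q : ℕ) {a : ℝ} (ha : 0 < a) (x : ℝ) :
    |hermiteFun q x| ≤ (a * (1 + x ^ 2)⁻¹ + a⁻¹ * ((1 + x ^ 2) * hermiteFun q x ^ 2)) / 2 := by
  have hsq : 0 ≤ a⁻¹ * (1 + x ^ 2)⁻¹ * (a - (1 + x ^ 2) * |hermiteFun q x|) ^ 2 := by positivity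
  have hexpand : a⁻¹ * (1 + x ^ 2)⁻¹ * (a - (1 + x ^ 2) * |hermiteFun q x|) ^ 2 =
      a * (1 + x ^ 2)⁻¹ + a⁻¹ * ((1 + x ^ 2) * |hermiteFun q x| ^ 2) - 2 * |hermiteFun q x| := by
    field_simp
    ring
  rw [hexpand, sq_abs] at hsq
  linarith

lemma one_add_sq_mul_hermiteFun_sq (q : ℕ) (x : ℝ) :
    (1 + x ^ 2) * hermiteFun q x ^ 2 = (gaussInt (gaussPoly q ^ 2))⁻¹ *
      ((gaussPoly q ^ 2 + Polynomial.X ^ 2 * gaussPoly q ^ 2).eval x * Real.exp (-x ^ 2)) := by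
  rw [hermiteFun_sq]
  simp only [Polynomial.eval_add, Polynomial.eval_mul, Polynomial.eval_pow, Polynomial.eval_X]
  ring

lemma integrable_one_add_sq_mul_hermiteFun_sq (q : ℕ) :
    Integrable fun x => (1 + x ^ 2) * hermiteFun q x ^ 2 := by
  simp only [one_add_sq_mul_hermiteFun_sq]
  exact (integrable_eval_mul_gaussian_one _).const_mul _

lemma integral_one_add_sq_mul_hermiteFun_sq_le (q : ℕ) :
    ∫ x, (1 + x ^ 2) * hermiteFun q x ^ 2 ≤ 2 * ((q : ℝ) + 1) := by
  simp only [one_add_sq_mul_hermiteFun_sq]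
  rw [integral_const_mul, ← gaussInt, gaussInt_add, inv_mul_le_iff₀ (gaussInt_gaussPoly_sq_pos q)]
  linarith [gaussInt_X_sq_mul_le q]

lemma integral_abs_hermiteFun_le (q : ℕ) : ∫ x, |hermiteFun q x| ≤ 3 * Real.sqrt (q + 1) := by
  set a := Real.sqrt (q + 1)
  have ha : 0 < a := Real.sqrt_pos.2 (by positivity)
  have ha_sq : a ^ 2 = q + 1 := Real.sq_sqrt (by positivity)
  have hi : Integrable fun x : ℝ => a * (1 + x ^ 2)⁻¹ := integrable_inv_one_add_sq.const_mul a
  have hi' := (integrable_one_add_sq_mul_hermiteFun_sq q).const_mul a⁻¹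
  calc ∫ x, |hermiteFun q x|
      ≤ ∫ x, (a * (1 + x ^ 2)⁻¹ + a⁻¹ * ((1 + x ^ 2) * hermiteFun q x ^ 2)) / 2 :=
        integral_mono (integrable_hermiteFun q).abs ((hi.add hi').div_const 2)
          (abs_hermiteFun_le q ha)
    _ = (a * Real.pi + a⁻¹ * ∫ x, (1 + x ^ 2) * hermiteFun q x ^ 2) / 2 := by
        rw [integral_div, integral_add hi hi', integral_const_mul, integral_const_mul,
          integral_univ_inv_one_add_sq]
    _ ≤ (a * 4 + a⁻¹ * (2 * (q + 1))) / 2 := by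
        gcongr
        · exact Real.pi_le_four
        · exact integral_one_add_sq_mul_hermiteFun_sq_le q
    _ = 3 * a := by
        rw [← ha_sq]
        field_simp
        ring

/-- A bound on the `L¹` norm of the Hermite function with multi-index `q`. -/
def hermiteBound (q : Fin d → ℕ) : ℝ := ∏ i, (3 * Real.sqrt ((q i : ℝ) + 1))

lemma one_le_hermiteBound (q : Fin d → ℕ) : 1 ≤ hermiteBound q := by
  refine Finset.prod_const_one.symm.trans_le
    (Finset.prod_le_prod (fun i _ => zero_le_one) fun i _ => ?_)
  have : 1 ≤ Real.sqrt ((q i : ℝ) + 1) := by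
    rw [Real.one_le_sqrt]; linarith [(q i).cast_nonneg (α := ℝ)]
  linarith

lemma hermiteBound_pos (q : Fin d → ℕ) : 0 < hermiteBound q :=
  one_pos.trans_le (one_le_hermiteBound q)

lemma integrable_space_prod {f : Fin d → ℝ → ℝ} (hf : ∀ i, Integrable (f i)) :
    Integrable fun x : Space d => ∏ i, f i (x i) :=
  ((PiLp.volume_preserving_ofLp (Fin d)).integrable_comp_emb
    (MeasurableEquiv.toLp 2 (Fin d → ℝ)).symm.measurableEmbedding).2 (Integrable.fintype_prod hf)

lemma integral_space_prod (f : Fin d → ℝ → ℝ) :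
    ∫ x : Space d, ∏ i, f i (x i) = ∏ i, ∫ x, f i x := by
  rw [← integral_fintype_prod_volume_eq_prod]
  exact (PiLp.volume_preserving_ofLp (Fin d)).integral_comp
    (MeasurableEquiv.toLp 2 (Fin d → ℝ)).symm.measurableEmbedding (fun y => ∏ i, f i (y i))

lemma integrable_hermiteFunD (q : Fin d → ℕ) :
    Integrable fun x : Space d => (hermiteFunD q x : ℂ) :=
  (integrable_space_prod fun i => integrable_hermiteFun (q i)).ofReal

lemma integral_norm_hermiteFunD_le (q : Fin d → ℕ) :
    ∫ x : Space d, ‖(hermiteFunD q x : ℂ)‖ ≤ hermiteBound q := by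
  simp only [Complex.norm_real, Real.norm_eq_abs, hermiteFunD, Finset.abs_prod]
  rw [integral_space_prod (fun i x => |hermiteFun (q i) x|)]
  exact Finset.prod_le_prod (fun i _ => integral_nonneg fun x => abs_nonneg _)
    fun i _ => integral_abs_hermiteFun_le _

lemma norm_hermiteFunD_sq (q : Fin d → ℕ) (x : Space d) :
    ‖(hermiteFunD q x : ℂ)‖ ^ 2 = ∏ i, hermiteFun (q i) (x i) ^ 2 := by
  rw [Complex.norm_real, Real.norm_eq_abs, sq_abs, hermiteFunD, Finset.prod_pow]

lemma memLp_hermiteFunD (q : Fin d → ℕ) :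
    MemLp (fun x : Space d => (hermiteFunD q x : ℂ)) 2 (volume : Measure (Space d)) := by
  rw [memLp_two_iff_integrable_sq_norm (integrable_hermiteFunD q).1]
  simp only [norm_hermiteFunD_sq]
  exact integrable_space_prod fun i => integrable_hermiteFun_sq (q i)

/-- The Hermite function with multi-index `q` as an element of `L²(ℝ^d)`. -/
def mode (q : Fin d → ℕ) : OneParticle d := toL2 fun x => (hermiteFunD q x : ℂ)

lemma norm_mode (q : Fin d → ℕ) : ‖mode q‖ = 1 := by
  have hinner : (inner ℂ (mode q) (mode q) : ℂ) = 1 := by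
    have hint : ∫ x : Space d, ∏ i, hermiteFun (q i) (x i) ^ 2 = 1 := by
      rw [integral_space_prod fun i x => hermiteFun (q i) x ^ 2]
      simp only [integral_hermiteFun_sq, Finset.prod_const_one]
    rw [L2.inner_def, ← Complex.ofReal_one, ← hint, ← integral_complex_ofReal, mode, toL2,
      dif_pos (memLp_hermiteFunD q)]
    refine integral_congr_ae ?_
    filter_upwards [(memLp_hermiteFunD q).coeFn_toLp] with x hx
    rw [hx, inner_self_eq_norm_sq_to_K, ← norm_hermiteFunD_sq, Complex.ofReal_pow]
    rfl
  have hsq : ‖mode q‖ ^ 2 = 1 := by rw [@norm_sq_eq_re_inner ℂ, hinner, RCLike.one_re]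
  exact (pow_eq_one_iff_of_nonneg (norm_nonneg _) two_ne_zero).1 hsq

/-- An integrable majorant of the correlations between normalized modes in dimension at least
`3`. -/
def decay (t : ℝ) : ℝ := 4 * (1 + |t|) ^ (-(3 / 2 : ℝ))

lemma integrable_decay : Integrable decay :=
  (integrable_one_add_norm (E := ℝ) (μ := volume) (r := 3 / 2) (by norm_num)).const_mul 4

lemma decay_nonneg (t : ℝ) : 0 ≤ decay t := by unfold decay; positivity

lemma rpow_neg_le_decay {t u : ℝ} (hu : 0 < u) (h : 1 + |t| ≤ 2 * u) :
    u ^ (-(3 / 2 : ℝ)) ≤ decay t := by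
  have htwo : (4 : ℝ)⁻¹ ≤ 2 ^ (-(3 / 2 : ℝ)) := by
    calc (4 : ℝ)⁻¹ = 2 ^ (-2 : ℝ) := by norm_num [Real.rpow_neg]
      _ ≤ 2 ^ (-(3 / 2 : ℝ)) := Real.rpow_le_rpow_of_exponent_le (by norm_num) (by norm_num)
  calc u ^ (-(3 / 2 : ℝ)) = 4 * (4⁻¹ * u ^ (-(3 / 2 : ℝ))) := by ring
    _ ≤ 4 * (2 ^ (-(3 / 2 : ℝ)) * u ^ (-(3 / 2 : ℝ))) := by gcongr
    _ = 4 * (2 * u) ^ (-(3 / 2 : ℝ)) := by rw [Real.mul_rpow zero_le_two hu.le]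
    _ ≤ decay t := by
        unfold decay
        gcongr 4 * ?_
        exact Real.rpow_le_rpow_of_nonpos (by positivity) h (by norm_num)

lemma one_le_decay {t : ℝ} (ht : |t| ≤ 1) : 1 ≤ decay t := by
  simpa only [Real.one_rpow] using rpow_neg_le_decay one_pos (by linarith)

lemma inv_rpow_le_decay (hd : 3 ≤ d) {t : ℝ} (ht : 1 < |t|) :
    (4 * Real.pi * |t|)⁻¹ ^ ((d : ℝ) / 2) ≤ decay t := by
  have hd' : (3 / 2 : ℝ) ≤ (d : ℝ) / 2 := by
    have : (3 : ℝ) ≤ d := by exact_mod_cast hd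
    linarith
  calc (4 * Real.pi * |t|)⁻¹ ^ ((d : ℝ) / 2) ≤ |t|⁻¹ ^ ((d : ℝ) / 2) := by
        gcongr
        nlinarith [Real.two_le_pi]
    _ ≤ |t|⁻¹ ^ (3 / 2 : ℝ) :=
        Real.rpow_le_rpow_of_exponent_ge (by positivity) (inv_le_one_of_one_le₀ ht.le) hd'
    _ = |t| ^ (-(3 / 2 : ℝ)) := by rw [Real.inv_rpow (abs_nonneg t), Real.rpow_neg (abs_nonneg t)]
    _ ≤ decay t := rpow_neg_le_decay (by positivity) (by linarith)

lemma norm_inner_mode_propagator_le (hd : 3 ≤ d) (q q' : Fin d → ℕ) (t : ℝ) :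
    ‖(inner ℂ (mode q) (propagator t (mode q')) : ℂ)‖ ≤
      decay t * (hermiteBound q * hermiteBound q') := by
  rcases le_or_gt |t| 1 with ht | ht
  · calc ‖(inner ℂ (mode q) (propagator t (mode q')) : ℂ)‖
        ≤ ‖mode q‖ * (‖propagator t‖ * ‖mode q'‖) :=
          (norm_inner_le_norm _ _).trans (by gcongr; exact ContinuousLinearMap.le_opNorm _ _)
      _ ≤ 1 := by simpa only [norm_mode, one_mul, mul_one] using norm_propagator_le t
      _ ≤ decay t * (hermiteBound q * hermiteBound q') :=
          one_le_mul_of_one_le_of_one_le (one_le_decay ht)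
            (one_le_mul_of_one_le_of_one_le (one_le_hermiteBound q) (one_le_hermiteBound q'))
  · refine (norm_inner_propagator_le (integrable_hermiteFunD q) (memLp_hermiteFunD q)
      (integrable_hermiteFunD q') (memLp_hermiteFunD q') (abs_pos.1 (by linarith))).trans ?_
    rw [mul_assoc]
    gcongr
    · exact decay_nonneg t
    · exact inv_rpow_le_decay hd ht
    · exact (hermiteBound_pos q).le
    · exact integral_norm_hermiteFunD_le q
    · exact integral_norm_hermiteFunD_le q'

lemma summable_prod_fin {g : ℕ → ℝ} (hg : Summable g) (h0 : ∀ n, 0 ≤ g n) (n : ℕ) :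
    Summable fun q : Fin n → ℕ => ∏ i, g (q i) := by
  induction n with
  | zero => exact (hasSum_fintype _).summable
  | succ n ih =>
    rw [← (Fin.consEquiv fun _ : Fin (n + 1) => ℕ).summable_iff]
    have := hg.mul_of_nonneg ih h0 fun q => Finset.prod_nonneg fun i _ => h0 _
    simpa [Function.comp_def, Fin.prod_univ_succ, Fin.consEquiv] using this

lemma hermiteBound_sq (q : Fin d → ℕ) : hermiteBound q ^ 2 = ∏ i, (9 * ((q i : ℝ) + 1)) := by
  rw [hermiteBound, ← Finset.prod_pow]
  refine Finset.prod_congr rfl fun i _ => ?_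
  rw [mul_pow, Real.sq_sqrt (by positivity)]
  norm_num

lemma summable_hermiteBound_sq_div :
    Summable fun q : Fin d → ℕ => hermiteBound q ^ 2 / ∏ i, ((q i : ℝ) + 1) ^ 3 := by
  have h : Summable fun n : ℕ => 9 * (1 / ((n + 1 : ℕ) : ℝ) ^ 2) :=
    ((summable_nat_add_iff 1).2 (Real.summable_one_div_nat_pow.2 one_lt_two)).mul_left 9
  refine (summable_prod_fin h (fun n => by positivity) d).congr fun q => ?_
  rw [hermiteBound_sq, ← Finset.prod_div_distrib]
  refine Finset.prod_congr rfl fun i _ => ?_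
  have : (q i : ℝ) + 1 ≠ 0 := by positivity
  push_cast
  field_simp

end HermiteFunctions

section NuclearOperators

variable {E ι : Type*} [NormedAddCommGroup E] [InnerProductSpace ℂ E] {e : ι → E}
  {a o : ι × ι → ℂ}

/-- The matrix element `T ↦ ⟨x, T y⟩` as a bounded functional. -/
def matrixElement (x y : E) : (E →L[ℂ] E) →L[ℂ] ℂ :=
  (innerSL ℂ x).comp (ContinuousLinearMap.apply ℂ E y)

lemma matrixElement_apply (x y : E) (T : E →L[ℂ] E) : matrixElement x y T = inner ℂ x (T y) := rfl

lemma norm_matrixElement_le (x y : E) : ‖matrixElement x y‖ ≤ ‖x‖ * ‖y‖ := by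
  refine ContinuousLinearMap.opNorm_le_bound _ (by positivity) fun T => ?_
  calc ‖matrixElement x y T‖ ≤ ‖x‖ * (‖T‖ * ‖y‖) :=
        (norm_inner_le_norm _ _).trans (by gcongr; exact T.le_opNorm y)
    _ = ‖x‖ * ‖y‖ * ‖T‖ := by ring

/-- The nuclear operator `∑_{i,j} a_{ij} |e_i⟩⟨e_j|`. -/
def matrixOp (e : ι → E) (a : ι × ι → ℂ) : E →L[ℂ] E :=
  ∑' Q, a Q • InnerProductSpace.rankOne ℂ (e Q.1) (e Q.2)

/-- The functional `T ↦ tr (matrixOp e a * T)`. -/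
def traceMul (e : ι → E) (a : ι × ι → ℂ) : (E →L[ℂ] E) →L[ℂ] ℂ :=
  ∑' Q, a Q • matrixElement (e Q.2) (e Q.1)

lemma hasSum_smul_of_norm_le_one {F : Type*} [NormedAddCommGroup F] [NormedSpace ℂ F]
    [CompleteSpace F] {κ : Type*} {c : κ → ℂ} {x : κ → F} (hc : Summable fun k => ‖c k‖)
    (hx : ∀ k, ‖x k‖ ≤ 1) : HasSum (fun k => c k • x k) (∑' k, c k • x k) := by
  refine (Summable.of_norm_bounded hc fun k => ?_).hasSum
  rw [norm_smul]
  exact mul_le_of_le_one_right (norm_nonneg _) (hx k)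

lemma hasSum_traceMul (he : ∀ i, ‖e i‖ ≤ 1) (ha : Summable fun Q => ‖a Q‖) (T : E →L[ℂ] E) :
    HasSum (fun Q => a Q * inner ℂ (e Q.2) (T (e Q.1))) (traceMul e a T) := by
  have hsum : HasSum (fun Q => a Q • matrixElement (e Q.2) (e Q.1)) (traceMul e a) :=
    hasSum_smul_of_norm_le_one (x := fun Q : ι × ι => matrixElement (e Q.2) (e Q.1)) ha fun Q =>
      (norm_matrixElement_le _ _).trans (mul_le_one₀ (he Q.2) (norm_nonneg _) (he Q.1))
  exact hsum.mapL (ContinuousLinearMap.apply ℂ ℂ T)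

lemma continuous_traceMul {X : Type*} [TopologicalSpace X] {T : X → E →L[ℂ] E} {M : ℝ}
    (he : ∀ i, ‖e i‖ ≤ 1) (ha : Summable fun Q => ‖a Q‖)
    (hT : ∀ f, Continuous fun x => T x f) (hM : ∀ x, ‖T x‖ ≤ M) :
    Continuous fun x => traceMul e a (T x) := by
  simp only [← (hasSum_traceMul he ha _).tsum_eq]
  refine continuous_tsum (fun Q => continuous_const.mul (continuous_const.inner (hT _)))
    (ha.mul_right M) fun Q x => ?_
  rw [norm_mul]
  gcongr
  calc ‖(inner ℂ (e Q.2) (T x (e Q.1)) : ℂ)‖ ≤ ‖e Q.2‖ * ‖T x (e Q.1)‖ := norm_inner_le_norm _ _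
    _ ≤ 1 * ‖T x (e Q.1)‖ := by gcongr; exact he _
    _ ≤ 1 * (M * 1) := by gcongr; exact (T x).le_of_opNorm_le_of_le (hM x) (he _)
    _ = M := by ring

variable [CompleteSpace E]

lemma hasSum_matrixOp (he : ∀ i, ‖e i‖ ≤ 1) (ha : Summable fun Q => ‖a Q‖) :
    HasSum (fun Q => a Q • InnerProductSpace.rankOne ℂ (e Q.1) (e Q.2)) (matrixOp e a) :=
  hasSum_smul_of_norm_le_one ha fun Q => by
    rw [InnerProductSpace.norm_rankOne]
    exact mul_le_one₀ (he Q.1) (norm_nonneg _) (he Q.2)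

lemma hasSum_inner_mul_matrixOp (he : ∀ i, ‖e i‖ ≤ 1) (ha : Summable fun Q => ‖a Q‖)
    (T : E →L[ℂ] E) (f g : E) :
    HasSum (fun Q => a Q * (inner ℂ f (T (e Q.1)) * inner ℂ (e Q.2) g))
      (inner ℂ f (T (matrixOp e a g))) := by
  have hsum := (hasSum_matrixOp he ha).mapL
    ((matrixElement f g).comp (ContinuousLinearMap.mul ℂ (E →L[ℂ] E) T))
  convert! hsum using 2 with Q
  simp only [ContinuousLinearMap.coe_comp, Function.comp_apply, map_smul, smul_eq_mul,
    ContinuousLinearMap.mul_apply', matrixElement_apply, mul_apply_eq_comp,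
    InnerProductSpace.rankOne_apply, inner_smul_right]
  ring

lemma traceMul_mul_rankOne_mul (he : ∀ i, ‖e i‖ ≤ 1) (ha : Summable fun Q => ‖a Q‖)
    (S T : E →L[ℂ] E) (x y : E) :
    traceMul e a (S * InnerProductSpace.rankOne ℂ x y * T) =
      inner ℂ y (T (matrixOp e a (S x))) := by
  refine (hasSum_traceMul he ha _).unique ?_
  convert hasSum_inner_mul_matrixOp he ha T y (S x) using 2 with Q
  simp only [mul_apply_eq_comp, InnerProductSpace.rankOne_apply, map_smul, inner_smul_right]

lemma traceMul_mul_matrixOp_mul (he : ∀ i, ‖e i‖ ≤ 1) (ha : Summable fun Q => ‖a Q‖)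
    (ho : Summable fun Q => ‖o Q‖) (S T : E →L[ℂ] E) :
    traceMul e a (S * matrixOp e o * T) = traceMul e o (T * matrixOp e a * S) := by
  have hsum := (hasSum_matrixOp he ho).mapL
    ((traceMul e a).comp (ContinuousLinearMap.mulLeftRight ℂ (E →L[ℂ] E) S T))
  refine hsum.unique ?_
  convert hasSum_traceMul he ho (T * matrixOp e a * S) using 2 with Q
  simp only [ContinuousLinearMap.coe_comp, Function.comp_apply, map_smul, smul_eq_mul,
    ContinuousLinearMap.mulLeftRight_apply, traceMul_mul_rankOne_mul he ha, mul_apply_eq_comp]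

lemma norm_traceMul_mul_matrixOp_mul_le (he : ∀ i, ‖e i‖ ≤ 1) (ha : Summable fun Q => ‖a Q‖)
    (ho : Summable fun Q => ‖o Q‖) {b : ι → ℝ} (hb : ∀ i, 0 ≤ b i)
    (hab : Summable fun Q => ‖a Q‖ * b Q.2) (hob : Summable fun Q => ‖o Q‖ * b Q.1)
    {S T : E →L[ℂ] E} {D M : ℝ} (hD : 0 ≤ D)
    (hS : ∀ i j, ‖(inner ℂ (e i) (S (e j)) : ℂ)‖ ≤ D * (b i * b j)) (hT : ‖T‖ ≤ M) :
    ‖traceMul e a (S * matrixOp e o * T)‖ ≤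
      D * M * ((∑' Q, ‖a Q‖ * b Q.2) * ∑' Q, ‖o Q‖ * b Q.1) := by
  have hM : 0 ≤ M := (norm_nonneg T).trans hT
  have hTe (i j : ι) : ‖(inner ℂ (e i) (T (e j)) : ℂ)‖ ≤ M :=
    calc ‖(inner ℂ (e i) (T (e j)) : ℂ)‖ ≤ ‖e i‖ * (‖T‖ * ‖e j‖) :=
          (norm_inner_le_norm _ _).trans (by gcongr; exact T.le_opNorm _)
      _ ≤ 1 * (M * 1) := by gcongr <;> apply he
      _ = M := by ring
  have hinner (Q : ι × ι) : ‖(inner ℂ (e Q.2) ((S * matrixOp e o * T) (e Q.1)) : ℂ)‖ ≤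
      D * M * b Q.2 * ∑' Q', ‖o Q'‖ * b Q'.1 := by
    refine (hasSum_inner_mul_matrixOp he ho S (e Q.2) (T (e Q.1))).norm_le_of_bounded
      (hob.hasSum.mul_left _) fun Q' => ?_
    rw [norm_mul, norm_mul]
    calc ‖o Q'‖ * (‖(inner ℂ (e Q.2) (S (e Q'.1)) : ℂ)‖ * ‖(inner ℂ (e Q'.2) (T (e Q.1)) : ℂ)‖)
        ≤ ‖o Q'‖ * (D * (b Q.2 * b Q'.1) * M) := by
          have := hb Q.2
          have := hb Q'.1
          gcongr
          · exact hS _ _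
          · exact hTe _ _
      _ = D * M * b Q.2 * (‖o Q'‖ * b Q'.1) := by ring
  rw [← tsum_mul_right, ← tsum_mul_left]
  refine (hasSum_traceMul he ha _).norm_le_of_bounded ((hab.mul_right _).mul_left _).hasSum
    fun Q => ?_
  rw [norm_mul]
  calc ‖a Q‖ * ‖(inner ℂ (e Q.2) ((S * matrixOp e o * T) (e Q.1)) : ℂ)‖
      ≤ ‖a Q‖ * (D * M * b Q.2 * ∑' Q', ‖o Q'‖ * b Q'.1) := by gcongr; exact hinner Q
    _ = D * M * (‖a Q‖ * b Q.2 * ∑' Q', ‖o Q'‖ * b Q'.1) := by ring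

lemma continuous_mul_matrixOp {X : Type*} [TopologicalSpace X] {S : X → E →L[ℂ] E} {M : ℝ}
    (he : ∀ i, ‖e i‖ ≤ 1) (ho : Summable fun Q => ‖o Q‖)
    (hS : ∀ f, Continuous fun x => S x f) (hM : ∀ x, ‖S x‖ ≤ M) :
    Continuous fun x => S x * matrixOp e o := by
  have hterm (x : X) : HasSum
      (fun Q => o Q • InnerProductSpace.rankOne ℂ (S x (e Q.1)) (e Q.2)) (S x * matrixOp e o) := by
    convert! (hasSum_matrixOp he ho).mapL (ContinuousLinearMap.mul ℂ (E →L[ℂ] E) (S x)) using 2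
    simp only [map_smul, ContinuousLinearMap.mul_apply', ContinuousLinearMap.mul_def,
      InnerProductSpace.comp_rankOne]
  simp only [← (hterm _).tsum_eq]
  refine continuous_tsum (fun Q => ?_) (ho.mul_right M) fun Q x => ?_
  · have := hS (e Q.1)
    fun_prop
  · rw [norm_smul, InnerProductSpace.norm_rankOne]
    gcongr
    calc ‖S x (e Q.1)‖ * ‖e Q.2‖ ≤ ‖S x (e Q.1)‖ * 1 := by gcongr; exact he _
      _ ≤ M * 1 * 1 := by gcongr; exact (S x).le_of_opNorm_le_of_le (hM x) (he _)
      _ = M := by ring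

end NuclearOperators

section Correlations

variable {d : ℕ} {a o v v' : (Fin d → ℕ) × (Fin d → ℕ) → ℂ}

/-- Matrices in the basis of Hermite functions which are absolutely summable with the weights that
control the dispersive decay of the modes. -/
def Tame (a : (Fin d → ℕ) × (Fin d → ℕ) → ℂ) : Prop :=
  Summable fun Q => ‖a Q‖ * (hermiteBound Q.1 * hermiteBound Q.2)

lemma Tame.summable_left (ha : Tame a) : Summable fun Q => ‖a Q‖ * hermiteBound Q.1 :=
  ha.of_nonneg_of_le (fun Q => mul_nonneg (norm_nonneg _) (hermiteBound_pos _).le) fun Q => by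
    gcongr
    exact le_mul_of_one_le_right (hermiteBound_pos _).le (one_le_hermiteBound _)

lemma Tame.summable_right (ha : Tame a) : Summable fun Q => ‖a Q‖ * hermiteBound Q.2 :=
  ha.of_nonneg_of_le (fun Q => mul_nonneg (norm_nonneg _) (hermiteBound_pos _).le) fun Q => by
    gcongr
    exact le_mul_of_one_le_left (hermiteBound_pos _).le (one_le_hermiteBound _)

lemma Tame.summable_norm (ha : Tame a) : Summable fun Q => ‖a Q‖ :=
  ha.summable_left.of_nonneg_of_le (fun _ => norm_nonneg _) fun _ =>
    le_mul_of_one_le_right (norm_nonneg _) (one_le_hermiteBound _)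

lemma Tame.const_mul (ha : Tame a) (z : ℂ) : Tame fun Q => z * a Q := by
  simpa only [Tame, norm_mul, mul_assoc] using Summable.mul_left ‖z‖ ha

lemma norm_mode_le_one (q : Fin d → ℕ) : ‖mode q‖ ≤ 1 := (norm_mode q).le

/-- The correlation `tr (â e^{it(-Δ)} ô e^{-it(-Δ)} m(-Δ))` of the operators with Hermite matrices
`a` and `o`. -/
def timeCorr (a o : (Fin d → ℕ) × (Fin d → ℕ) → ℂ) (m : Symbol) (t : ℝ) : ℂ :=
  traceMul mode a (propagator t * matrixOp mode o * (propagator (-t) * energyOp m))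

lemma timeCorr_eq_traceMul_right (ha : Tame a) (ho : Tame o) (m : Symbol) (t : ℝ) :
    timeCorr a o m t =
      traceMul mode o (propagator (-t) * energyOp m * matrixOp mode a * propagator t) :=
  traceMul_mul_matrixOp_mul norm_mode_le_one ha.summable_norm ho.summable_norm _ _

lemma matrixOp_const_mul (z : ℂ) :
    matrixOp mode (fun Q => z * a Q) = z • matrixOp mode a := by
  simp only [matrixOp, mul_smul, tsum_const_smul'']

lemma traceMul_const_mul (z : ℂ) : traceMul mode (fun Q => z * a Q) = z • traceMul mode a := by
  simp only [traceMul, mul_smul, tsum_const_smul'']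

lemma timeCorr_const_mul_left (z : ℂ) (m : Symbol) (t : ℝ) :
    timeCorr (fun Q => z * a Q) o m t = z * timeCorr a o m t := by
  simp only [timeCorr, traceMul_const_mul, smul_apply, smul_eq_mul]

lemma timeCorr_const_mul_right (z : ℂ) (m : Symbol) (t : ℝ) :
    timeCorr a (fun Q => z * o Q) m t = z * timeCorr a o m t := by
  simp only [timeCorr, matrixOp_const_mul, mul_smul_comm, smul_mul_assoc, map_smul, smul_eq_mul]

lemma norm_propagator_mul_energyOp_le (m : Symbol) (t : ℝ) :
    ‖(propagator t * energyOp m : OneParticle d →L[ℂ] OneParticle d)‖ ≤ ‖m‖ :=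
  calc ‖(propagator t * energyOp m : OneParticle d →L[ℂ] OneParticle d)‖
      ≤ 1 * ‖m‖ := (norm_mul_le _ _).trans
        (by gcongr; exacts [norm_propagator_le t, norm_energyOp_le m])
    _ = ‖m‖ := one_mul _

lemma exists_norm_timeCorr_le (hd : 3 ≤ d) (ha : Tame a) (ho : Tame o) :
    ∃ C, ∀ m t, ‖timeCorr a o m t‖ ≤ decay t * ‖m‖ * C :=
  ⟨_, fun m t => norm_traceMul_mul_matrixOp_mul_le norm_mode_le_one ha.summable_norm
    ho.summable_norm (fun q => (hermiteBound_pos q).le) ha.summable_right ho.summable_left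
    (decay_nonneg t) (fun q q' => norm_inner_mode_propagator_le hd q q' t)
    (norm_propagator_mul_energyOp_le m (-t))⟩

lemma continuous_timeCorr (ha : Tame a) (ho : Tame o) (m : Symbol) :
    Continuous (timeCorr a o m) := by
  have hleft : Continuous fun t : ℝ => propagator t * matrixOp mode o :=
    continuous_mul_matrixOp norm_mode_le_one ho.summable_norm continuous_propagator_apply
      norm_propagator_le
  refine continuous_traceMul (M := ‖matrixOp mode o‖ * ‖m‖) norm_mode_le_one ha.summable_norm
    (fun f => ?_) fun t => ?_
  · exact hleft.clm_apply ((continuous_propagator_apply _).comp continuous_neg)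
  · calc ‖propagator t * matrixOp mode o * (propagator (-t) * energyOp m)‖
        ≤ 1 * ‖matrixOp mode o‖ * ‖m‖ := by
          refine norm_mul₃_le.trans ?_
          gcongr
          exacts [norm_propagator_le t, norm_propagator_mul_energyOp_le m (-t)]
      _ = ‖matrixOp mode o‖ * ‖m‖ := by rw [one_mul]

lemma integrable_timeCorr (hd : 3 ≤ d) (ha : Tame a) (ho : Tame o) (m : Symbol) :
    Integrable (timeCorr a o m) := by
  obtain ⟨C, hC⟩ := exists_norm_timeCorr_le hd ha ho
  exact ((integrable_decay.mul_const ‖m‖).mul_const C).mono'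
    (continuous_timeCorr ha ho m).aestronglyMeasurable (ae_of_all _ (hC m))

/-- The integral over all times of the correlation `timeCorr a o m`, as a bounded functional
of `m`. -/
def integralCorr (hd : 3 ≤ d) (ha : Tame a) (ho : Tame o) : Symbol →L[ℂ] ℂ :=
  LinearMap.mkContinuousOfExistsBound
    { toFun := fun m => ∫ t, timeCorr a o m t
      map_add' := fun m m' => by
        rw [← integral_add (integrable_timeCorr hd ha ho m) (integrable_timeCorr hd ha ho m')]
        simp only [timeCorr, map_add, mul_add]
      map_smul' := fun z m => by
        rw [RingHom.id_apply, ← integral_smul]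
        simp only [timeCorr, map_smul, mul_smul_comm] } <| by
    obtain ⟨C, hC⟩ := exists_norm_timeCorr_le hd ha ho
    refine ⟨(∫ t, decay t) * C, fun m => ?_⟩
    calc ‖∫ t, timeCorr a o m t‖ ≤ ∫ t, decay t * ‖m‖ * C :=
          norm_integral_le_of_norm_le ((integrable_decay.mul_const _).mul_const C)
            (ae_of_all _ (hC m))
      _ = (∫ t, decay t) * C * ‖m‖ := by
          rw [integral_mul_const, integral_mul_const]
          ring

lemma integralCorr_apply (hd : 3 ≤ d) (ha : Tame a) (ho : Tame o) (m : Symbol) :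
    integralCorr hd ha ho m = ∫ t, timeCorr a o m t := rfl

lemma hasDerivAt_propagator_mul {T T' : OneParticle d →L[ℂ] OneParticle d}
    (hT : HasDerivAt (fun u => propagator u * T) T' 0) (t : ℝ) :
    HasDerivAt (fun u => propagator u * T) (propagator t * T') t := by
  have hshift := HasDerivAt.comp_sub_const t t (by rwa [sub_self])
  refine (hshift.const_mul (propagator t)).congr_of_eventuallyEq (.of_forall fun u => ?_)
  simp only [← mul_assoc, ← propagator_add, add_sub_cancel]

lemma hasDerivAt_clm_comp {E F : Type*} [NormedAddCommGroup E] [NormedSpace ℂ E]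
    [NormedAddCommGroup F] [NormedSpace ℂ F] (L : E →L[ℂ] F) {T : ℝ → E} {T' : E} {t : ℝ}
    (hT : HasDerivAt T T' t) : HasDerivAt (fun u => L (T u)) (L T') t :=
  (L.restrictScalars ℝ).hasFDerivAt.comp_hasDerivAt t hT

lemma hasDerivAt_propagator_neg_mul_energyOp {m m₁ m₂ : Symbol}
    (h₁ : ∀ e : ℝ≥0, m₁ e = ((e : ℝ) : ℂ) * m e) (h₂ : ∀ e : ℝ≥0, m₂ e = ((e : ℝ) : ℂ) * m₁ e)
    (t : ℝ) :
    HasDerivAt (fun u => (propagator (-u) * energyOp m : OneParticle d →L[ℂ] OneParticle d))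
      (-Complex.I • (propagator (-t) * energyOp m₁)) t := by
  have hphase := (hasDerivAt_phase_mul h₁ h₂ (-t)).scomp t (hasDerivAt_neg t)
  have hop := hasDerivAt_clm_comp ((energyOp (d := d)).toAlgHom.toLinearMap.mkContinuous 1
    fun φ => (norm_energyOp_le φ).trans_eq (one_mul _).symm) hphase
  convert! hop using 1
  · funext u
    exact (map_mul energyOp _ _).symm
  · rw [propagator, ← map_mul, neg_one_smul, map_neg, map_smul, neg_smul]
    rfl

/-- The derivative in time acts on `ô` and, because `m(-Δ)` commutes with the propagator, by
multiplication of `m` with the energy. -/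
lemma hasDerivAt_timeCorr (hv : HasDerivAt (fun u => propagator u * matrixOp mode o)
    (matrixOp mode v) 0) {m m₁ m₂ : Symbol} (h₁ : ∀ e : ℝ≥0, m₁ e = ((e : ℝ) : ℂ) * m e)
    (h₂ : ∀ e : ℝ≥0, m₂ e = ((e : ℝ) : ℂ) * m₁ e) (t : ℝ) :
    HasDerivAt (timeCorr a o m) (timeCorr a v m t - Complex.I * timeCorr a o m₁ t) t := by
  have hprod := (hasDerivAt_propagator_mul hv t).mul
    (hasDerivAt_propagator_neg_mul_energyOp h₁ h₂ t)
  refine (hasDerivAt_clm_comp (traceMul mode a) hprod).congr_deriv ?_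
  simp only [timeCorr, map_add, mul_smul_comm, map_smul, neg_smul, smul_eq_mul, sub_eq_add_neg,
    map_neg, mul_neg]

lemma integral_timeCorr_of_hasDerivAt (hd : 3 ≤ d) (ha : Tame a) (ho : Tame o) (hv : Tame v)
    (hov : HasDerivAt (fun u => propagator u * matrixOp mode o) (matrixOp mode v) 0)
    {m m₁ m₂ : Symbol} (h₁ : ∀ e : ℝ≥0, m₁ e = ((e : ℝ) : ℂ) * m e)
    (h₂ : ∀ e : ℝ≥0, m₂ e = ((e : ℝ) : ℂ) * m₁ e) :
    ∫ t, timeCorr a v m t = Complex.I * ∫ t, timeCorr a o m₁ t := by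
  have hi := integrable_timeCorr hd ha hv m
  have hi₁ := (integrable_timeCorr hd ha ho m₁).const_mul Complex.I
  have hzero := integral_eq_zero_of_hasDerivAt_of_integrable (hasDerivAt_timeCorr hov h₁ h₂)
    (hi.sub hi₁) (integrable_timeCorr hd ha ho m)
  rwa [integral_sub hi hi₁, integral_const_mul, sub_eq_zero] at hzero

lemma timeCorr_eq_neg_of_hasDerivAt (ha : Tame a) (ho : Tame o) (hv' : Tame v')
    (hov : HasDerivAt (fun u => propagator u * matrixOp mode o) (matrixOp mode v) 0)
    (hav : HasDerivAt (fun u => matrixOp mode a * propagator (-u)) (matrixOp mode v') 0)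
    (m : Symbol) (t : ℝ) : timeCorr v' o m t = -timeCorr a v m t := by
  have hright := hasDerivAt_clm_comp (traceMul mode a)
    ((hov.const_mul (propagator t)).mul_const (propagator (-t) * energyOp m))
  have hleft := hasDerivAt_clm_comp (traceMul mode o)
    ((hav.const_mul (propagator (-t) * energyOp m)).mul_const (propagator t))
  have hswap (u : ℝ) : traceMul mode a
      (propagator t * (propagator u * matrixOp mode o) * (propagator (-t) * energyOp m)) =
      traceMul mode o (propagator (-t) * energyOp m * (matrixOp mode a * propagator (- -u)) *
        propagator t) := by
    rw [← mul_assoc (propagator t), traceMul_mul_matrixOp_mul norm_mode_le_one ha.summable_norm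
      ho.summable_norm, neg_neg, ← propagator_add, add_comm, propagator_add]
    simp only [mul_assoc]
  have hflip := HasDerivAt.scomp (0 : ℝ) (by simpa only [neg_zero] using hleft) (hasDerivAt_neg 0)
  have hunique := hright.unique (hflip.congr_of_eventuallyEq (.of_forall hswap))
  rw [timeCorr_eq_traceMul_right hv' ho, timeCorr, hunique, neg_smul, one_smul, neg_neg]

lemma timeCorr_eq_zero_of_right (h : matrixOp mode o = 0) (m : Symbol) (t : ℝ) :
    timeCorr a o m t = 0 := by
  simp only [timeCorr, h, mul_zero, zero_mul, map_zero]

lemma timeCorr_eq_zero_of_left (ha : Tame a) (ho : Tame o) (h : matrixOp mode a = 0) (m : Symbol)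
    (t : ℝ) : timeCorr a o m t = 0 := by
  simp only [timeCorr_eq_traceMul_right ha ho, h, mul_zero, zero_mul, map_zero]

end Correlations

section SecondQuantization

instance : Fintype Reservoir := ⟨{Reservoir.I, Reservoir.II}, fun r => by cases r <;> simp⟩

lemma sum_reservoir {M : Type*} [AddCommMonoid M] (f : Reservoir → M) :
    ∑ r, f r = f Reservoir.I + f Reservoir.II := by
  have : (Finset.univ : Finset Reservoir) = {Reservoir.I, Reservoir.II} := rfl
  rw [this, Finset.sum_pair (by decide)]

variable {d : ℕ} {A : Type*} [CStarAlgebra A]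

namespace CARAlgebra

variable (C : CARAlgebra d A)

lemma anticomm_star_star (r s : Reservoir) (f g : OneParticle d) :
    star (C.annih r f) * star (C.annih s g) + star (C.annih s g) * star (C.annih r f) = 0 := by
  rw [← star_mul, ← star_mul, ← star_add, C.anticomm, star_zero]

lemma norm_annih_le (r : Reservoir) (f : OneParticle d) : ‖C.annih r f‖ ≤ ‖f‖ := by
  set a := C.annih r f with ha
  have hsq : a * a = 0 := by
    have h := C.anticomm r r f f
    rwa [← two_smul ℂ, smul_eq_zero_iff_right two_ne_zero] at h
  have hanti : a * star a = ((‖f‖ ^ 2 : ℝ) : ℂ) • (1 : A) - star a * a := by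
    rw [eq_sub_iff_add_eq, ha, C.anticomm_star, if_pos rfl, inner_self_eq_norm_sq_to_K]
    norm_cast
  have hproj : star (star a * a) * (star a * a) = ((‖f‖ ^ 2 : ℝ) : ℂ) • (star a * a) :=
    calc star (star a * a) * (star a * a) = star a * (a * star a) * a := by
          rw [star_mul, star_star]
          simp only [mul_assoc]
      _ = ((‖f‖ ^ 2 : ℝ) : ℂ) • (star a * a) - star a * star a * (a * a) := by
          rw [hanti, mul_sub, sub_mul, mul_smul_comm, mul_one, smul_mul_assoc]
          simp only [mul_assoc]
      _ = ((‖f‖ ^ 2 : ℝ) : ℂ) • (star a * a) := by rw [hsq, mul_zero, sub_zero]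
  have hnorm : ‖star a * a‖ * ‖star a * a‖ = ‖f‖ ^ 2 * ‖star a * a‖ := by
    rw [← CStarRing.norm_star_mul_self, hproj, norm_smul, Complex.norm_real,
      Real.norm_of_nonneg (by positivity)]
  rcases eq_or_ne ‖a‖ 0 with h | h
  · rw [h]
    exact norm_nonneg f
  · rw [CStarRing.norm_star_mul_self] at hnorm
    have heq := mul_right_cancel₀ (mul_self_ne_zero.2 h) hnorm
    exact (sq_le_sq₀ (norm_nonneg a) (norm_nonneg f)).1 ((pow_two _).trans_le heq.le)

lemma continuous_annih (r : Reservoir) : Continuous (C.annih r) :=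
  ((C.annih r).mkContinuous 1 fun f => by simpa only [one_mul] using C.norm_annih_le r f).continuous

/-- The operator `a*(f, r) a(g, s)`, which moves a particle from the mode `g` of the reservoir `s`
to the mode `f` of the reservoir `r`. -/
def hop (r s : Reservoir) (f g : OneParticle d) : A := star (C.annih r f) * C.annih s g

lemma norm_hop_le (r s : Reservoir) (f g : OneParticle d) : ‖C.hop r s f g‖ ≤ ‖f‖ * ‖g‖ := by
  refine (norm_mul_le _ _).trans ?_
  rw [norm_star]
  gcongr
  exacts [C.norm_annih_le r f, C.norm_annih_le s g]

lemma norm_hop_mode_le_one (r s : Reservoir) (q q' : Fin d → ℕ) :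
    ‖C.hop r s (mode q) (mode q')‖ ≤ 1 :=
  (C.norm_hop_le _ _ _ _).trans
    (mul_le_one₀ (norm_mode_le_one _) (norm_nonneg _) (norm_mode_le_one _))

/-- The element `x` generates the one-particle transformation with components `T r s`: its
commutators with creation and annihilation operators are those of the second quantization of `T`,
so that `x` is determined by `T` up to elements commuting with the whole field algebra. -/
structure IsSecondQuantization (x : A)
    (T : Matrix Reservoir Reservoir (OneParticle d →L[ℂ] OneParticle d)) : Prop where
  commutator_creation : ∀ s g, x * star (C.annih s g) - star (C.annih s g) * x =
    ∑ r, star (C.annih r (T r s g))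
  commutator_annihilation : ∀ r f, x * C.annih r f - C.annih r f * x =
    -∑ s, C.annih s (star (T r s) f)

variable {C} {x y : A} {T T' : Matrix Reservoir Reservoir (OneParticle d →L[ℂ] OneParticle d)}

namespace IsSecondQuantization

lemma sub (hx : C.IsSecondQuantization x T) (hy : C.IsSecondQuantization y T') :
    C.IsSecondQuantization (x - y) (T - T') where
  commutator_creation s g := by
    simp only [Matrix.sub_apply, sub_apply, map_sub, star_sub, Finset.sum_sub_distrib,
      ← hx.commutator_creation, ← hy.commutator_creation]
    noncomm_ring
  commutator_annihilation r f := by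
    simp only [Matrix.sub_apply, star_sub, sub_apply, map_sub, Finset.sum_sub_distrib, neg_sub',
      ← hx.commutator_annihilation, ← hy.commutator_annihilation]
    noncomm_ring

lemma smul (hx : C.IsSecondQuantization x T) (z : ℂ) : C.IsSecondQuantization (z • x) (z • T) where
  commutator_creation s g := by
    simp only [Matrix.smul_apply, smul_apply, map_smulₛₗ, star_smul, RCLike.star_def,
      Complex.conj_conj, ← Finset.smul_sum, ← hx.commutator_creation, smul_mul_assoc,
      mul_smul_comm, smul_sub]
  commutator_annihilation r f := by
    simp only [Matrix.smul_apply, star_smul, smul_apply, map_smulₛₗ, RCLike.star_def,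
      Complex.conj_conj, ← Finset.smul_sum, ← smul_neg, ← hx.commutator_annihilation,
      smul_mul_assoc, mul_smul_comm, smul_sub]

lemma hasSum {ι : Type*} {x : ι → A} {y : A}
    {T : ι → Matrix Reservoir Reservoir (OneParticle d →L[ℂ] OneParticle d)} (hx : HasSum x y)
    (hT : ∀ r s, HasSum (fun i => T i r s) (T' r s))
    (h : ∀ i, C.IsSecondQuantization (x i) (T i)) : C.IsSecondQuantization y T' where
  commutator_creation s g := by
    have hr (r : Reservoir) : HasSum (fun i => star (C.annih r (T i r s g)))
        (star (C.annih r (T' r s g))) :=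
      (((hT r s).mapL (ContinuousLinearMap.apply ℂ _ g)).map (C.annih r)
        (C.continuous_annih r)).star
    refine ((hx.mul_right _).sub (hx.mul_left _)).unique ?_
    simpa only [(h _).commutator_creation] using hasSum_sum fun r _ => hr r
  commutator_annihilation r f := by
    have hs (s : Reservoir) : HasSum (fun i => C.annih s (star (T i r s) f))
        (C.annih s (star (T' r s) f)) :=
      ((hT r s).star.mapL (ContinuousLinearMap.apply ℂ _ f)).map (C.annih s)
        (C.continuous_annih s)
    refine ((hx.mul_right _).sub (hx.mul_left _)).unique ?_
    simpa only [(h _).commutator_annihilation] using (hasSum_sum fun s _ => hs s).neg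

lemma map {φ : A →⋆ₐ[ℂ] A} {U : Reservoir → OneParticle d →L[ℂ] OneParticle d}
    (hφ : ∀ r f, φ (C.annih r f) = C.annih r (U r f)) (hU : ∀ r, U r * star (U r) = 1)
    (hx : C.IsSecondQuantization x T) :
    C.IsSecondQuantization (φ x) fun r s => U r * T r s * star (U s) := by
  have hannih (r : Reservoir) (f : OneParticle d) :
      C.annih r f = φ (C.annih r (star (U r) f)) := by
    rw [hφ, ← mul_apply_eq_comp, hU, one_apply_eq_self]
  refine ⟨fun s g => ?_, fun r f => ?_⟩
  · rw [hannih, ← map_star, ← map_mul, ← map_mul, ← map_sub, hx.commutator_creation, map_sum]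
    simp only [map_star, hφ, mul_apply_eq_comp]
  · rw [hannih, ← map_mul, ← map_mul, ← map_sub, hx.commutator_annihilation, map_neg, map_sum]
    simp only [hφ, mul_apply_eq_comp, star_mul, star_star]

lemma annih_anticommutator (hx : C.IsSecondQuantization x T) (r s : Reservoir)
    (f g : OneParticle d) :
    C.annih r f * (x * star (C.annih s g) - star (C.annih s g) * x) +
      (x * star (C.annih s g) - star (C.annih s g) * x) * C.annih r f =
    (inner ℂ f (T r s g) : ℂ) • (1 : A) := by
  rw [hx.commutator_creation, Finset.mul_sum, Finset.sum_mul, ← Finset.sum_add_distrib]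
  simp only [C.anticomm_star, Finset.sum_ite_eq, Finset.mem_univ, if_true]

lemma norm_apply_le [Nontrivial A] (hx : C.IsSecondQuantization x T) (r s : Reservoir) :
    ‖T r s‖ ≤ 4 * ‖x‖ := by
  refine ContinuousLinearMap.opNorm_le_of_re_inner_le (by positivity) fun g f hg hf => ?_
  set k := x * star (C.annih s g) - star (C.annih s g) * x
  have hf₁ : ‖C.annih r f‖ ≤ 1 := hf ▸ C.norm_annih_le r f
  have hg₁ : ‖star (C.annih s g)‖ ≤ 1 := norm_star (C.annih s g) ▸ hg ▸ C.norm_annih_le s g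
  have hk : ‖k‖ ≤ 2 * ‖x‖ :=
    calc ‖k‖ ≤ ‖x‖ * ‖star (C.annih s g)‖ + ‖star (C.annih s g)‖ * ‖x‖ :=
          (norm_sub_le _ _).trans (add_le_add (norm_mul_le _ _) (norm_mul_le _ _))
      _ ≤ ‖x‖ * 1 + 1 * ‖x‖ := by gcongr
      _ = 2 * ‖x‖ := by ring
  calc RCLike.re (inner ℂ (T r s g) f : ℂ) ≤ ‖(inner ℂ f (T r s g) : ℂ) • (1 : A)‖ := by
        rw [norm_smul, CStarRing.norm_one, mul_one, norm_inner_symm]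
        exact RCLike.re_le_norm _
    _ = ‖C.annih r f * k + k * C.annih r f‖ := by rw [hx.annih_anticommutator]
    _ ≤ ‖C.annih r f‖ * ‖k‖ + ‖k‖ * ‖C.annih r f‖ :=
        (norm_add_le _ _).trans (add_le_add (norm_mul_le _ _) (norm_mul_le _ _))
    _ ≤ 1 * (2 * ‖x‖) + 2 * ‖x‖ * 1 := by gcongr
    _ = 4 * ‖x‖ := by ring

lemma hasDerivAt [Nontrivial A] {x : ℝ → A} {x' : A} {t : ℝ}
    {T : ℝ → Matrix Reservoir Reservoir (OneParticle d →L[ℂ] OneParticle d)}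
    (hx : HasDerivAt x x' t) (hT : ∀ u, C.IsSecondQuantization (x u) (T u))
    (hT' : C.IsSecondQuantization x' T') (r s : Reservoir) :
    HasDerivAt (fun u => T u r s) (T' r s) t := by
  refine hasDerivAt_iff_isLittleO.2 ((Asymptotics.IsBigO.of_bound 4 (.of_forall fun u => ?_))
    |>.trans_isLittleO (hasDerivAt_iff_isLittleO.1 hx))
  exact (((hT u).sub (hT t)).sub (hT'.smul ((u - t : ℝ) : ℂ))).norm_apply_le r s

end IsSecondQuantization

variable (C)

lemma isSecondQuantization_hop (r s : Reservoir) (h k : OneParticle d) :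
    C.IsSecondQuantization (C.hop r s h k)
      (Matrix.single r s (InnerProductSpace.rankOne ℂ h k)) where
  commutator_creation q g := by
    have hcomm : C.hop r s h k * star (C.annih q g) - star (C.annih q g) * C.hop r s h k =
        star (C.annih r h) * (C.annih s k * star (C.annih q g) + star (C.annih q g) * C.annih s k) -
        (star (C.annih r h) * star (C.annih q g) + star (C.annih q g) * star (C.annih r h)) *
          C.annih s k := by
      rw [hop]
      noncomm_ring
    rw [hcomm, C.anticomm_star, C.anticomm_star_star, zero_mul, sub_zero]
    rw [Fintype.sum_eq_single r fun p hp => by simp [Matrix.single_apply_of_row_ne hp.symm]]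
    rcases eq_or_ne s q with rfl | hsq
    · simp [Matrix.single_apply_same]
    · simp [hsq]
  commutator_annihilation p f := by
    have hcomm : C.hop r s h k * C.annih p f - C.annih p f * C.hop r s h k =
        star (C.annih r h) * (C.annih s k * C.annih p f + C.annih p f * C.annih s k) -
        (C.annih p f * star (C.annih r h) + star (C.annih r h) * C.annih p f) * C.annih s k := by
      rw [hop]
      noncomm_ring
    rw [hcomm, C.anticomm_star, C.anticomm, mul_zero, zero_sub]
    rw [Fintype.sum_eq_single s fun q hq => by simp [Matrix.single_apply_of_col_ne _ _ hq.symm]]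
    rcases eq_or_ne p r with rfl | hpr
    · simp [Matrix.single_apply_same, ContinuousLinearMap.star_eq_adjoint]
    · simp [Matrix.single_apply_of_row_ne hpr.symm, hpr]

/-- The operator `∑_{q,q'} a_{qq'} a*(φ_q, r) a(φ_q', s)`, which moves particles from the reservoir
`s` to the reservoir `r`. -/
def hopSum (r s : Reservoir) (a : (Fin d → ℕ) × (Fin d → ℕ) → ℂ) : A :=
  ∑' Q, a Q • C.hop r s (mode Q.1) (mode Q.2)

/-- The second quantization of the one-particle operator whose components have the Hermite
matrices `c r s`. -/
def secondQuantization (c : Reservoir → Reservoir → (Fin d → ℕ) × (Fin d → ℕ) → ℂ) : A :=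
  ∑ r, ∑ s, C.hopSum r s (c r s)

variable {C} {a : (Fin d → ℕ) × (Fin d → ℕ) → ℂ}

lemma hasSum_hopSum (r s : Reservoir) (ha : Tame a) :
    HasSum (fun Q => a Q • C.hop r s (mode Q.1) (mode Q.2)) (C.hopSum r s a) :=
  hasSum_smul_of_norm_le_one ha.summable_norm fun _ => C.norm_hop_mode_le_one _ _ _ _

lemma hopSum_const_mul (r s : Reservoir) (z : ℂ) :
    C.hopSum r s (fun Q => z * a Q) = z • C.hopSum r s a := by
  simp only [hopSum, mul_smul, tsum_const_smul'']

lemma isSecondQuantization_hopSum (r s : Reservoir) (ha : Tame a) :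
    C.IsSecondQuantization (C.hopSum r s a) (Matrix.single r s (matrixOp mode a)) := by
  refine .hasSum (hasSum_hopSum r s ha) (fun p q => ?_)
    fun Q => (C.isSecondQuantization_hop r s _ _).smul (a Q)
  have h := hasSum_matrixOp norm_mode_le_one ha.summable_norm
  by_cases hpq : r = p ∧ s = q
  · obtain ⟨rfl, rfl⟩ := hpq
    simpa only [Matrix.smul_apply, Matrix.single_apply_same] using h
  · simp only [Matrix.smul_apply, Matrix.single_apply, if_neg hpq, smul_zero, hasSum_zero]

lemma isSecondQuantization_secondQuantization
    {c : Reservoir → Reservoir → (Fin d → ℕ) × (Fin d → ℕ) → ℂ} (hc : ∀ r s, Tame (c r s)) :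
    C.IsSecondQuantization (C.secondQuantization c) fun r s => matrixOp mode (c r s) := by
  rw [secondQuantization, ← Fintype.sum_prod_type' fun r s => C.hopSum r s (c r s)]
  refine .hasSum (hasSum_fintype _) (fun r s => ?_)
    fun p => isSecondQuantization_hopSum p.1 p.2 (hc p.1 p.2)
  convert! hasSum_fintype fun p : Reservoir × Reservoir =>
    Matrix.single p.1 p.2 (matrixOp mode (c p.1 p.2)) r s
  rw [Fintype.sum_prod_type]
  simp [Matrix.single_apply, ite_and]

end CARAlgebra

end SecondQuantization

section OneBodyKernels

variable {d : ℕ}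

lemma mul_le_mul_sq_add_sq_div {p : ℝ} (hp : 0 < p) {x y : ℝ} (hx : 0 ≤ x) (hy : 0 ≤ y) :
    x * y ≤ p * x ^ 2 + y ^ 2 / p := by
  have hsq : p * x ^ 2 + y ^ 2 / p - 2 * (x * y) = (p * x - y) ^ 2 / p := by
    field_simp
    ring
  have : 0 ≤ (p * x - y) ^ 2 / p := by positivity
  linarith [mul_nonneg hx hy]

/-- The Hermite matrix of the component of a one-body kernel which moves a particle from the
reservoir `s` to the reservoir `r`. -/
def Kernel.matrix (w : Kernel d 1) (r s : Reservoir) (Q : (Fin d → ℕ) × (Fin d → ℕ)) : ℂ :=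
  w.coeff (fun _ => r) (fun _ => s) (fun _ => Q.1) fun _ => Q.2

lemma Kernel.HasFiniteNorm.tame_matrix {w : Kernel d 1} (hw : w.HasFiniteNorm) (r s : Reservoir) :
    Tame (w.matrix r s) := by
  set weight : (Fin d → ℕ) → ℝ := fun q => ∏ i, ((q i : ℝ) + 1) ^ 3
  have hweight (q : Fin d → ℕ) : 0 < weight q := Finset.prod_pos fun i _ => by positivity
  have hsob : Summable fun Q : (Fin d → ℕ) × (Fin d → ℕ) =>
      weight Q.1 * weight Q.2 * ‖w.matrix r s Q‖ ^ 2 := by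
    let e := (Equiv.funUnique (Fin 1) (Fin d → ℕ)).symm
    refine ((e.prodCongr e).summable_iff.2 (hw (fun _ => r) fun _ => s).2).congr fun Q => ?_
    simp only [Function.comp_apply, Equiv.prodCongr_apply, Prod.map, Finset.univ_unique,
      Finset.prod_singleton, Finset.prod_mul_distrib]
    rfl
  have hbound := (summable_hermiteBound_sq_div (d := d)).mul_of_nonneg
    (summable_hermiteBound_sq_div (d := d))
    (fun q => div_nonneg (sq_nonneg _) (hweight q).le)
    (fun q => div_nonneg (sq_nonneg _) (hweight q).le)
  refine (hsob.add hbound).of_nonneg_of_le (fun Q => mul_nonneg (norm_nonneg _)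
    (mul_pos (hermiteBound_pos _) (hermiteBound_pos _)).le) fun Q => ?_
  rw [div_mul_div_comm, ← mul_pow]
  exact mul_le_mul_sq_add_sq_div (mul_pos (hweight _) (hweight _)) (norm_nonneg _)
    (mul_pos (hermiteBound_pos _) (hermiteBound_pos _)).le

lemma CARAlgebra.quantize_eq_secondQuantization {A : Type*} [CStarAlgebra A] (C : CARAlgebra d A)
    {w : Kernel d 1} (hw : w.HasFiniteNorm) : C.quantize w = C.secondQuantization w.matrix := by
  let e := (Equiv.funUnique (Fin 1) (Reservoir × (Fin d → ℕ))).symm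
  let comm := Equiv.prodProdProdComm Reservoir Reservoir (Fin d → ℕ) (Fin d → ℕ)
  have hnorm : Summable fun z : (Reservoir × Reservoir) × ((Fin d → ℕ) × (Fin d → ℕ)) =>
      ‖w.matrix z.1.1 z.1.2 z.2‖ := (summable_prod_of_nonneg fun _ => norm_nonneg _).2
    ⟨fun p => (hw.tame_matrix p.1 p.2).summable_norm, (hasSum_fintype _).summable⟩
  have hsum := (hasSum_smul_of_norm_le_one hnorm fun z =>
    C.norm_hop_mode_le_one z.1.1 z.1.2 z.2.1 z.2.2).summable
  rw [quantize, ← (comm.trans (e.prodCongr e)).tsum_eq]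
  calc _ = ∑' z : (Reservoir × Reservoir) × ((Fin d → ℕ) × (Fin d → ℕ)),
        w.matrix z.1.1 z.1.2 z.2 • C.hop z.1.1 z.1.2 (mode z.2.1) (mode z.2.2) :=
        tsum_congr fun z => by
          simp [hop, Kernel.matrix, mode, e, comm, Equiv.prodCongr_apply, uniqueElim_const]
    _ = C.secondQuantization w.matrix := by
        rw [hsum.tsum_prod, tsum_fintype, Fintype.sum_prod_type]
        rfl

end OneBodyKernels

section ReservoirDynamics

open scoped CStarAlgebra

variable {d : ℕ} {A : Type*} [CStarAlgebra A] (S : FreeReservoirs d A)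
  {c : Reservoir → Reservoir → (Fin d → ℕ) × (Fin d → ℕ) → ℂ}

namespace FreeReservoirs

lemma evol_annih_propagator (r : Reservoir) (t : ℝ) (s : Reservoir) (f : OneParticle d) :
    S.evol r t (S.annih s f) = S.annih s ((if s = r then propagator t else 1) f) := by
  rw [S.evol_annih, freeProp_eq_propagator]
  split_ifs <;> rfl

lemma freeEvol_annih (t : ℝ) (s : Reservoir) (f : OneParticle d) :
    S.freeEvol t (S.annih s f) = S.annih s (propagator t f) := by
  rw [freeEvol, StarAlgHom.comp_apply, evol_annih_propagator, evol_annih_propagator]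
  cases s <;> simp

lemma isSecondQuantization_freeEvol {x : A}
    {T : Matrix Reservoir Reservoir (OneParticle d →L[ℂ] OneParticle d)}
    (hx : S.IsSecondQuantization x T) (t : ℝ) :
    S.IsSecondQuantization (S.freeEvol t x) fun r s => propagator t * T r s * propagator (-t) := by
  simpa only [star_propagator] using
    hx.map (S.freeEvol_annih t) fun _ => propagator_mul_star_propagator t

lemma hasDerivAt_matrixOp [Nontrivial A]
    {v : Reservoir → Reservoir → (Fin d → ℕ) × (Fin d → ℕ) → ℂ} (hc : ∀ r s, Tame (c r s))
    (hv : ∀ r s, Tame (v r s))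
    (h : HasDerivAt (fun u : ℝ => S.evol Reservoir.I u (S.secondQuantization c))
      (S.secondQuantization v) 0) (r s : Reservoir) :
    HasDerivAt (fun u : ℝ => (if r = Reservoir.I then propagator u else 1) * matrixOp mode (c r s) *
      star (if s = Reservoir.I then propagator u else 1)) (matrixOp mode (v r s)) 0 := by
  refine CARAlgebra.IsSecondQuantization.hasDerivAt (T := fun u r s =>
    (if r = Reservoir.I then propagator u else 1) * matrixOp mode (c r s) *
      star (if s = Reservoir.I then propagator u else 1)) h (fun u => ?_)
    (CARAlgebra.isSecondQuantization_secondQuantization hv) r s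
  refine (CARAlgebra.isSecondQuantization_secondQuantization hc).map
    (S.evol_annih_propagator Reservoir.I u) fun p => ?_
  split_ifs
  exacts [propagator_mul_star_propagator u, by rw [star_one, one_mul]]

lemma freeEvol_hop (t : ℝ) (r s : Reservoir) (f g : OneParticle d) :
    S.freeEvol t (S.hop r s f g) = S.hop r s (propagator t f) (propagator t g) := by
  rw [CARAlgebra.hop, map_mul, map_star, freeEvol_annih, freeEvol_annih, CARAlgebra.hop]

lemma freeEvol_hopSum (t : ℝ) (r s : Reservoir) {a : (Fin d → ℕ) × (Fin d → ℕ) → ℂ}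
    (ha : Tame a) : S.freeEvol t (S.hopSum r s a) =
      ∑' Q, a Q • S.hop r s (propagator t (mode Q.1)) (propagator t (mode Q.2)) := by
  simpa only [Function.comp_def, map_smul, freeEvol_hop] using
    (((CARAlgebra.hasSum_hopSum (C := S.toCARAlgebra) r s ha).map (S.freeEvol t)
      (map_continuous _)).tsum_eq).symm

lemma continuous_freeEvol_secondQuantization (hc : ∀ r s, Tame (c r s)) :
    Continuous fun t : ℝ => S.freeEvol t (S.secondQuantization c) := by
  have hmode (r : Reservoir) (q : Fin d → ℕ) :
      Continuous fun t : ℝ => S.annih r (propagator t (mode q)) :=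
    (S.continuous_annih r).comp (continuous_propagator_apply (mode q))
  have hnorm (t : ℝ) (q : Fin d → ℕ) : ‖propagator t (mode q)‖ ≤ 1 :=
    ((propagator t).le_of_opNorm_le (norm_propagator_le t) _).trans
      (mul_le_one₀ le_rfl (norm_nonneg _) (norm_mode_le_one q))
  simp only [CARAlgebra.secondQuantization, map_sum, S.freeEvol_hopSum _ _ _ (hc _ _)]
  refine continuous_finsetSum _ fun r _ => continuous_finsetSum _ fun s _ => ?_
  refine continuous_tsum (fun Q => continuous_const.smul ((hmode r _).star.mul (hmode s _)))
    (hc r s).summable_norm fun Q t => ?_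
  rw [norm_smul]
  exact mul_le_of_le_one_right (norm_nonneg _) ((S.norm_hop_le _ _ _ _).trans
    (mul_le_one₀ (hnorm _ _) (norm_nonneg _) (hnorm _ _)))

end FreeReservoirs

/-- The contribution of a particle in a given reservoir to the particle number of the
reservoir `I`. -/
def charge : Reservoir → ℂ
  | Reservoir.I => 1
  | Reservoir.II => 0

namespace FreeReservoirs

lemma gauge_annih_charge (t : ℝ) (s : Reservoir) (f : OneParticle d) :
    S.gauge Reservoir.I t (S.annih s f) =
      Complex.exp (-(Complex.I * t * charge s)) • S.annih s f := by
  rw [S.gauge_annih]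
  cases s
  · simp [charge, map_smulₛₗ, ← Complex.exp_conj]
  · simp [charge]

lemma gauge_hop (t : ℝ) (r s : Reservoir) (f g : OneParticle d) :
    S.gauge Reservoir.I t (S.hop r s f g) =
      Complex.exp (Complex.I * (charge r - charge s) * t) • S.hop r s f g := by
  have hstar : star (Complex.exp (-(Complex.I * t * charge r))) =
      Complex.exp (Complex.I * t * charge r) := by
    cases r <;> simp [charge, ← Complex.exp_conj]
  rw [CARAlgebra.hop, map_mul, map_star, gauge_annih_charge, gauge_annih_charge, star_smul,
    smul_mul_smul_comm, hstar, ← Complex.exp_add]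
  ring_nf

lemma gauge_hopSum (t : ℝ) (r s : Reservoir) {a : (Fin d → ℕ) × (Fin d → ℕ) → ℂ} (ha : Tame a) :
    S.gauge Reservoir.I t (S.hopSum r s a) =
      Complex.exp (Complex.I * (charge r - charge s) * t) • S.hopSum r s a := by
  refine HasSum.unique ((CARAlgebra.hasSum_hopSum (C := S.toCARAlgebra) r s ha).map
    (S.gauge Reservoir.I t) (map_continuous _)) ?_
  simpa only [Function.comp_def, map_smul, gauge_hop, smul_comm (a _)] using
    (CARAlgebra.hasSum_hopSum (C := S.toCARAlgebra) r s ha).const_smul _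

lemma hasDerivAt_gauge_secondQuantization (hc : ∀ r s, Tame (c r s)) :
    HasDerivAt (fun u : ℝ => S.gauge Reservoir.I u (S.secondQuantization c))
      (S.secondQuantization fun r s Q => Complex.I * (charge r - charge s) * c r s Q) 0 := by
  simp only [CARAlgebra.secondQuantization, map_sum, S.gauge_hopSum _ _ _ (hc _ _),
    CARAlgebra.hopSum_const_mul]
  refine HasDerivAt.fun_sum fun r _ => HasDerivAt.fun_sum fun s _ => HasDerivAt.smul_const ?_ _
  simpa using ((hasDerivAt_id (0 : ℝ)).ofReal_comp.const_mul
    (Complex.I * (charge r - charge s))).cexp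

end FreeReservoirs

end ReservoirDynamics

section LinearResponse

variable {d : ℕ} {A : Type*} [CStarAlgebra A] {C : CARAlgebra d A} {ω : A →L[ℂ] ℂ}
  {D : Reservoir → OneParticle d →L[ℂ] OneParticle d}

namespace CARAlgebra

lemma IsQuasiFreeState.apply_hop (hω : C.IsQuasiFreeState (fun r => D r) ω) (r s : Reservoir)
    (f g : OneParticle d) : ω (C.hop r s f g) = if r = s then inner ℂ g (D r f) else 0 := by
  simpa [hop] using hω.wick 1 (fun _ => (r, f)) fun _ => (s, g)

lemma IsQuasiFreeState.apply_commutator_hop (hω : C.IsQuasiFreeState (fun r => D r) ω) {x : A}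
    {X : Matrix Reservoir Reservoir (OneParticle d →L[ℂ] OneParticle d)}
    (hx : C.IsSecondQuantization x X) (r s : Reservoir) (f g : OneParticle d) :
    ω (x * C.hop r s f g - C.hop r s f g * x) =
      inner ℂ g ((D s * X s r - X s r * D r) f) := by
  have hcomm : x * C.hop r s f g - C.hop r s f g * x =
      (∑ p, C.hop p s (X p r f) g) - ∑ q, C.hop r q f (star (X s q) g) := by
    calc x * C.hop r s f g - C.hop r s f g * x
        = (x * star (C.annih r f) - star (C.annih r f) * x) * C.annih s g +
          star (C.annih r f) * (x * C.annih s g - C.annih s g * x) := by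
          rw [hop]
          noncomm_ring
      _ = _ := by
          rw [hx.commutator_creation, hx.commutator_annihilation, Finset.sum_mul, mul_neg,
            Finset.mul_sum, ← sub_eq_add_neg]
          rfl
  simp only [hcomm, map_sub, map_sum, hω.apply_hop, Finset.sum_ite_eq', Finset.sum_ite_eq,
    Finset.mem_univ, if_true, sub_apply, inner_sub_right, mul_apply_eq_comp,
    ContinuousLinearMap.star_eq_adjoint, ContinuousLinearMap.adjoint_inner_left]

lemma IsQuasiFreeState.apply_commutator_hopSum (hω : C.IsQuasiFreeState (fun r => D r) ω) {x : A}
    {X : Matrix Reservoir Reservoir (OneParticle d →L[ℂ] OneParticle d)}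
    (hx : C.IsSecondQuantization x X) (r s : Reservoir)
    {a : (Fin d → ℕ) × (Fin d → ℕ) → ℂ} (ha : Tame a) :
    ω (x * C.hopSum r s a - C.hopSum r s a * x) =
      traceMul mode a (D s * X s r - X s r * D r) := by
  have hsum := hasSum_hopSum (C := C) r s ha
  refine ((((hsum.mul_left x).sub (hsum.mul_right x)).mapL ω).unique ?_)
  simpa only [mul_smul_comm, smul_mul_assoc, ← smul_sub, map_smul, smul_eq_mul,
    hω.apply_commutator_hop hx] using hasSum_traceMul norm_mode_le_one ha.summable_norm _

end CARAlgebra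

/-- The contribution of the reservoir `r` to the first-order response at time `t` of the observable
with Hermite matrices `o` to the interaction with Hermite matrices `c`, when the one-particle
density operator of this reservoir is the function `m` of the energy. -/
def reservoirResponse (c o : Reservoir → Reservoir → (Fin d → ℕ) × (Fin d → ℕ) → ℂ)
    (r : Reservoir) (m : Symbol) (t : ℝ) : ℂ :=
  ∑ s, (timeCorr (c r s) (o s r) m t - timeCorr (o r s) (c s r) m (-t))

variable {c o : Reservoir → Reservoir → (Fin d → ℕ) × (Fin d → ℕ) → ℂ} {m : Reservoir → Symbol}

namespace FreeReservoirs

variable (S : FreeReservoirs d A)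

lemma apply_commutator_freeEvol (hω : S.IsQuasiFreeState (fun r => energyOp (m r)) ω)
    (hc : ∀ r s, Tame (c r s)) (ho : ∀ r s, Tame (o r s)) (t : ℝ) :
    ω (S.freeEvol (-t) (S.secondQuantization c) * S.secondQuantization o -
      S.secondQuantization o * S.freeEvol (-t) (S.secondQuantization c)) =
    ∑ r, reservoirResponse c o r (m r) t := by
  have hx := S.isSecondQuantization_freeEvol
    (CARAlgebra.isSecondQuantization_secondQuantization (C := S.toCARAlgebra) hc) (-t)
  generalize S.freeEvol (-t) (S.secondQuantization c) = x at hx ⊢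
  have hterm (r s : Reservoir) : ω (x * S.hopSum r s (o r s) - S.hopSum r s (o r s) * x) =
      timeCorr (c s r) (o r s) (m s) t - timeCorr (o r s) (c s r) (m r) (-t) := by
    have hcomm : propagator (-t) * energyOp (m s) =
        (energyOp (m s) * propagator (-t) : OneParticle d →L[ℂ] OneParticle d) :=
      commute_energyOp _ _
    rw [CARAlgebra.IsQuasiFreeState.apply_commutator_hopSum hω hx r s (ho r s), map_sub,
      timeCorr_eq_traceMul_right (hc s r) (ho r s), timeCorr, neg_neg, hcomm]
    simp only [mul_assoc]
  simp only [CARAlgebra.secondQuantization, Finset.mul_sum, Finset.sum_mul,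
    ← Finset.sum_sub_distrib, map_sum, hterm, reservoirResponse]
  simp only [Finset.sum_sub_distrib]
  rw [Finset.sum_comm]

lemma expectationTerm_two_two {W O : ℕ → A} (hW : Continuous fun t => S.freeEvol t (W 1))
    (β μ : Reservoir → ℝ) (t : ℝ) :
    S.expectationTerm W O 2 2 β μ t = Complex.I * ∫ u in (0 : ℝ)..t,
      S.equilibrium β μ (S.freeEvol (-u) (W 1) * O 1 - O 1 * S.freeEvol (-u) (W 1)) := by
  have hW' := hW.comp continuous_neg
  have hcont : Continuous fun u => S.freeEvol (-u) (W 1) * O 1 - O 1 * S.freeEvol (-u) (W 1) :=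
    (hW'.mul continuous_const).sub (continuous_const.mul hW')
  rw [ContinuousLinearMap.intervalIntegral_comp_comm _ (hcont.intervalIntegrable 0 t)]
  have hIcc : Finset.Icc 1 2 = {1, 2} := rfl
  simp [expectationTerm, hIcc, dyson]

end FreeReservoirs

end LinearResponse

section Transport

lemma integral_Ioi_add_comp_neg {f : ℝ → ℂ} (hf : Integrable f) :
    ∫ t in Set.Ioi 0, (f t + f (-t)) = ∫ t, f t := by
  rw [integral_add hf.integrableOn hf.comp_neg.integrableOn, integral_comp_neg_Ioi, neg_zero,
    add_comm, intervalIntegral.integral_Iic_add_Ioi hf.integrableOn hf.integrableOn]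

variable {d : ℕ} {c o v : Reservoir → Reservoir → (Fin d → ℕ) × (Fin d → ℕ) → ℂ}

lemma integrable_reservoirResponse (hd : 3 ≤ d) (hc : ∀ r s, Tame (c r s))
    (ho : ∀ r s, Tame (o r s)) (r : Reservoir) (m : Symbol) :
    Integrable (reservoirResponse c o r m) :=
  integrable_finsetSum _ fun s _ => (integrable_timeCorr hd (hc r s) (ho s r) m).sub
    (integrable_timeCorr hd (ho r s) (hc s r) m).comp_neg

/-- The contribution of the reservoir `r` to the stationary value of the flux with Hermite
matrices `o`, see `reservoirResponse`. -/
def stationaryFlux (c o : Reservoir → Reservoir → (Fin d → ℕ) × (Fin d → ℕ) → ℂ)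
    (r : Reservoir) (m : Symbol) : ℂ :=
  Complex.I * ∫ t in Set.Ioi 0, reservoirResponse c o r m t

lemma FreeReservoirs.tendsto_expectationTerm {A : Type*} [CStarAlgebra A] (S : FreeReservoirs d A)
    (hd : 3 ≤ d) (hc : ∀ r s, Tame (c r s)) (ho : ∀ r s, Tame (o r s)) {W O : ℕ → A}
    (hW : W 1 = S.secondQuantization c) (hO : O 1 = S.secondQuantization o)
    {β μ : Reservoir → ℝ} {m : Reservoir → Symbol}
    (hω : S.IsQuasiFreeState (fun r => energyOp (m r)) (S.equilibrium β μ)) :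
    Tendsto (S.expectationTerm W O 2 2 β μ) atTop (𝓝 (∑ r, stationaryFlux c o r (m r))) := by
  have hint := integrable_finsetSum Finset.univ fun r _ =>
    (integrable_reservoirResponse hd hc ho r (m r)).integrableOn (s := Set.Ioi 0)
  have hlim := (intervalIntegral_tendsto_integral_Ioi 0 hint tendsto_id).const_mul Complex.I
  rw [integral_finsetSum _ fun r _ =>
    (integrable_reservoirResponse hd hc ho r (m r)).integrableOn, Finset.mul_sum] at hlim
  refine hlim.congr fun t => ?_
  rw [S.expectationTerm_two_two (hW ▸ S.continuous_freeEvol_secondQuantization hc) β μ t, hW, hO]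
  simp only [S.apply_commutator_freeEvol hω hc ho, id]

/-- The net transport from the reservoir `II` to the reservoir `I` of a quantity distributed in
energy like `m`, to lowest order in the interaction with Hermite matrices `c`. -/
def netTransport (hd : 3 ≤ d) (hc : ∀ r s, Tame (c r s)) : Symbol →L[ℂ] ℂ :=
  integralCorr hd (hc Reservoir.II Reservoir.I) (hc Reservoir.I Reservoir.II)

/-- The Hermite matrices of the rate of gain of particles of the reservoir `I`, for an interaction
with Hermite matrices `c`. -/
def particleFluxMatrix (c : Reservoir → Reservoir → (Fin d → ℕ) × (Fin d → ℕ) → ℂ) :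
    Reservoir → Reservoir → (Fin d → ℕ) × (Fin d → ℕ) → ℂ :=
  fun r s Q => -1 * (Complex.I * (charge r - charge s) * c r s Q)

lemma stationaryFlux_particle (hd : 3 ≤ d) (hc : ∀ r s, Tame (c r s)) (m : Symbol) :
    stationaryFlux c (particleFluxMatrix c) Reservoir.II m = netTransport hd hc m := by
  have hresp (t : ℝ) : reservoirResponse c (particleFluxMatrix c) Reservoir.II m t =
      -Complex.I * (timeCorr (c Reservoir.II Reservoir.I) (c Reservoir.I Reservoir.II) m t +
        timeCorr (c Reservoir.II Reservoir.I) (c Reservoir.I Reservoir.II) m (-t)) := by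
    rw [reservoirResponse, sum_reservoir]
    unfold particleFluxMatrix
    simp only [timeCorr_const_mul_left, timeCorr_const_mul_right, charge]
    ring
  simp only [stationaryFlux, hresp]
  rw [integral_const_mul, integral_Ioi_add_comp_neg (integrable_timeCorr hd (hc _ _) (hc _ _) m),
    ← mul_assoc, mul_neg, Complex.I_mul_I, neg_neg, one_mul, netTransport, integralCorr_apply]

lemma stationaryFlux_energy (hd : 3 ≤ d) (hc : ∀ r s, Tame (c r s)) (hv : ∀ r s, Tame (v r s))
    {A : Type*} [CStarAlgebra A] [Nontrivial A] (S : FreeReservoirs d A)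
    (h : HasDerivAt (fun u : ℝ => S.evol Reservoir.I u (S.secondQuantization c))
      (S.secondQuantization v) 0) {m m₁ m₂ : Symbol}
    (h₁ : ∀ e : ℝ≥0, m₁ e = ((e : ℝ) : ℂ) * m e)
    (h₂ : ∀ e : ℝ≥0, m₂ e = ((e : ℝ) : ℂ) * m₁ e) :
    stationaryFlux c (fun r s Q => -1 * v r s Q) Reservoir.II m = netTransport hd hc m₁ := by
  have hderiv := S.hasDerivAt_matrixOp hc hv h
  have hov : HasDerivAt (fun u => propagator u * matrixOp mode (c Reservoir.I Reservoir.II))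
      (matrixOp mode (v Reservoir.I Reservoir.II)) 0 := by
    simpa using hderiv Reservoir.I Reservoir.II
  have hav : HasDerivAt (fun u => matrixOp mode (c Reservoir.II Reservoir.I) * propagator (-u))
      (matrixOp mode (v Reservoir.II Reservoir.I)) 0 := by
    simpa [star_propagator] using hderiv Reservoir.II Reservoir.I
  have hvII : matrixOp mode (v Reservoir.II Reservoir.II) = 0 :=
    (hderiv Reservoir.II Reservoir.II).unique (by simpa using hasDerivAt_const (0 : ℝ) _)
  have hresp (t : ℝ) : reservoirResponse c (fun r s Q => -1 * v r s Q) Reservoir.II m t =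
      -(timeCorr (c Reservoir.II Reservoir.I) (v Reservoir.I Reservoir.II) m t +
        timeCorr (c Reservoir.II Reservoir.I) (v Reservoir.I Reservoir.II) m (-t)) := by
    rw [reservoirResponse, sum_reservoir]
    simp only [timeCorr_const_mul_left, timeCorr_const_mul_right]
    rw [timeCorr_eq_neg_of_hasDerivAt (hc _ _) (hc _ _) (hv _ _) hov hav,
      timeCorr_eq_zero_of_right hvII, timeCorr_eq_zero_of_left (hv _ _) (hc _ _) hvII]
    ring
  simp only [stationaryFlux, hresp]
  rw [integral_neg, integral_Ioi_add_comp_neg (integrable_timeCorr hd (hc _ _) (hv _ _) m),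
    integral_timeCorr_of_hasDerivAt hd (hc _ _) (hc _ _) (hv _ _) hov h₁ h₂, netTransport,
    integralCorr_apply, mul_neg, ← mul_assoc, Complex.I_mul_I, neg_one_mul, neg_neg]

end Transport

section FermiFunctions

lemma sigmoid_le_exp (y : ℝ) : Real.sigmoid y ≤ Real.exp y := by
  have h := Real.sigmoid_mul_rexp_neg y
  rw [Real.exp_neg, ← div_eq_mul_inv, div_eq_iff (Real.exp_ne_zero y)] at h
  exact h.trans_le (mul_le_of_le_one_left (Real.exp_pos y).le (Real.sigmoid_le_one _))

/-- The derivative of the sigmoid function. -/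
def sigmoidDeriv (y : ℝ) : ℝ := Real.sigmoid y * (1 - Real.sigmoid y)

lemma continuous_sigmoidDeriv : Continuous sigmoidDeriv :=
  continuous_sigmoid.mul (continuous_const.sub continuous_sigmoid)

lemma sigmoidDeriv_nonneg (y : ℝ) : 0 ≤ sigmoidDeriv y :=
  mul_nonneg (Real.sigmoid_nonneg y) (sub_nonneg.2 (Real.sigmoid_le_one y))

lemma sigmoidDeriv_le_exp (y : ℝ) : sigmoidDeriv y ≤ Real.exp y :=
  (mul_le_of_le_one_right (Real.sigmoid_nonneg y)
    (sub_le_self 1 (Real.sigmoid_nonneg y))).trans (sigmoid_le_exp y)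

/-- The second derivative of the sigmoid function. -/
def sigmoidDeriv₂ (y : ℝ) : ℝ := sigmoidDeriv y * (1 - 2 * Real.sigmoid y)

lemma hasDerivAt_sigmoidDeriv (y : ℝ) : HasDerivAt sigmoidDeriv (sigmoidDeriv₂ y) y := by
  refine ((Real.hasDerivAt_sigmoid y).mul ((Real.hasDerivAt_sigmoid y).const_sub 1)).congr_deriv ?_
  simp only [sigmoidDeriv₂, sigmoidDeriv]
  ring

lemma abs_sigmoidDeriv₂_le_exp (y : ℝ) : |sigmoidDeriv₂ y| ≤ Real.exp y := by
  rw [sigmoidDeriv₂, abs_mul, abs_of_nonneg (sigmoidDeriv_nonneg y)]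
  refine (mul_le_of_le_one_right (sigmoidDeriv_nonneg y) (abs_le.2 ⟨?_, ?_⟩)).trans
    (sigmoidDeriv_le_exp y)
  · linarith [Real.sigmoid_le_one y]
  · linarith [Real.sigmoid_nonneg y]

lemma pow_mul_exp_sub_mul_le {β : ℝ} (hβ : 0 < β) (ν : ℝ) (k : ℕ) {e : ℝ} (he : 0 ≤ e) :
    e ^ k * Real.exp (ν - β * e) ≤ k.factorial / β ^ k * Real.exp ν := by
  have hpow := Real.pow_div_factorial_le_exp (β * e) (by positivity) k
  rw [Real.exp_sub, mul_div_assoc', div_le_iff₀ (Real.exp_pos _)]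
  calc e ^ k * Real.exp ν
      = k.factorial / β ^ k * Real.exp ν * ((β * e) ^ k / k.factorial) := by
        rw [mul_pow]
        field_simp
    _ ≤ k.factorial / β ^ k * Real.exp ν * Real.exp (β * e) := by gcongr

/-- The Fermi function `1 / (exp (β e - ν) + 1)` of the energy `e`, for `ν = β μ`. -/
def fermi (β ν : ℝ) : Symbol :=
  .ofNormedAddCommGroup (fun e => (Real.sigmoid (ν - β * e) : ℂ))
    (Complex.continuous_ofReal.comp (continuous_sigmoid.comp (by fun_prop))) 1 fun e => by
    rw [Complex.norm_real, Real.norm_of_nonneg (Real.sigmoid_nonneg _)]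
    exact Real.sigmoid_le_one _

/-- The function `e ^ k * g (ν - β e)` of the energy `e`, for a function `g` dominated by the
exponential function. -/
def thermalMoment {g : ℝ → ℝ} (hg : Continuous g) (h₀ : ∀ y, 0 ≤ g y)
    (h₁ : ∀ y, g y ≤ Real.exp y) {β : ℝ} (hβ : 0 < β) (ν : ℝ) (k : ℕ) : Symbol :=
  .ofNormedAddCommGroup (fun e => ((e ^ k * g (ν - β * e) : ℝ) : ℂ))
    (Complex.continuous_ofReal.comp (by fun_prop)) (k.factorial / β ^ k * Real.exp ν) fun e => by
    rw [Complex.norm_real, Real.norm_of_nonneg (mul_nonneg (by positivity) (h₀ _))]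
    exact (mul_le_mul_of_nonneg_left (h₁ _) (by positivity)).trans
      (pow_mul_exp_sub_mul_le hβ ν k e.2)

/-- The moment `e ^ k / (exp (β e - ν) + 1)` of the Fermi function. -/
abbrev fermiMoment {β : ℝ} (hβ : 0 < β) (ν : ℝ) (k : ℕ) : Symbol :=
  thermalMoment continuous_sigmoid Real.sigmoid_nonneg sigmoid_le_exp hβ ν k

lemma fermiMoment_one_apply {β : ℝ} (hβ : 0 < β) (ν : ℝ) (e : ℝ≥0) :
    fermiMoment hβ ν 1 e = ((e : ℝ) : ℂ) * fermi β ν e := by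
  simp [thermalMoment, fermi]

/-- The derivative of the Fermi function with respect to `ν`, multiplied with the energy. -/
abbrev energyFermiDeriv {β : ℝ} (hβ : 0 < β) (ν : ℝ) : Symbol :=
  thermalMoment continuous_sigmoidDeriv sigmoidDeriv_nonneg sigmoidDeriv_le_exp hβ ν 1

lemma hasDerivAt_fermi {β : ℝ} (hβ : 0 < β) (ν : ℝ) :
    HasDerivAt (fun x : ℝ => fermi (β - x) ν) (energyFermiDeriv hβ ν) 0 := by
  have hpath (e x : ℝ) : HasDerivAt (fun x => ν - (β - x) * e) e x := by
    simpa using (((hasDerivAt_id x).const_sub β).mul_const e).const_sub ν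
  refine hasDerivAt_of_norm_deriv_deriv_le (half_pos hβ) (F := fun x => fermi (β - x) ν)
    (f' := fun x e => ((sigmoidDeriv (ν - (β - x) * e) * e : ℝ) : ℂ))
    (f'' := fun x e => ((sigmoidDeriv₂ (ν - (β - x) * e) * e * e : ℝ) : ℂ))
    (C := (2).factorial / (β / 2) ^ 2 * Real.exp ν) (fun e => ?_)
    (fun x _ e => ((Real.hasDerivAt_sigmoid _).comp x (hpath e x)).ofReal_comp)
    (fun x _ e => (((hasDerivAt_sigmoidDeriv _).comp x (hpath e x)).mul_const _).ofReal_comp)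
    fun x hx e => ?_
  · simp [thermalMoment, mul_comm]
  · have hx' : β / 2 ≤ β - x := by
      have := abs_lt.1 (by simpa [Real.dist_eq] using hx)
      linarith
    rw [Complex.norm_real, mul_assoc, ← pow_two, norm_mul, mul_comm,
      Real.norm_of_nonneg (by positivity : (0 : ℝ) ≤ (e : ℝ) ^ 2)]
    refine le_trans ?_ (pow_mul_exp_sub_mul_le (half_pos hβ) ν 2 e.2)
    exact mul_le_mul_of_nonneg_left ((abs_sigmoidDeriv₂_le_exp _).trans (Real.exp_le_exp.2
      (sub_le_sub_left (mul_le_mul_of_nonneg_right hx' e.2) ν))) (by positivity)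

lemma hasDerivAt_fermiMoment_one {β : ℝ} (hβ : 0 < β) (ν : ℝ) :
    HasDerivAt (fun x : ℝ => fermiMoment hβ (ν - x) 1) (-energyFermiDeriv hβ ν) 0 := by
  have hpath (e x : ℝ) : HasDerivAt (fun x => ν - x - β * e) (-1) x :=
    ((hasDerivAt_id x).const_sub ν).sub_const _
  refine hasDerivAt_of_norm_deriv_deriv_le one_pos (F := fun x => fermiMoment hβ (ν - x) 1)
    (f' := fun x e => (((e : ℝ) ^ 1 * (sigmoidDeriv (ν - x - β * e) * -1) : ℝ) : ℂ))
    (f'' := fun x e => (((e : ℝ) ^ 1 * (sigmoidDeriv₂ (ν - x - β * e) * -1 * -1) : ℝ) : ℂ))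
    (C := (1).factorial / β ^ 1 * Real.exp (ν + 1)) (fun e => ?_)
    (fun x _ e => (((Real.hasDerivAt_sigmoid _).comp x (hpath e x)).const_mul _).ofReal_comp)
    (fun x _ e => ((((hasDerivAt_sigmoidDeriv _).comp x
      (hpath e x)).mul_const _).const_mul _).ofReal_comp)
    fun x hx e => ?_
  · simp [thermalMoment]
  · have hx' : -1 < x := (abs_lt.1 (by simpa [Real.dist_eq] using hx)).1
    rw [Complex.norm_real, norm_mul, mul_neg_one, mul_neg_one, neg_neg,
      Real.norm_of_nonneg (by positivity : (0 : ℝ) ≤ (e : ℝ) ^ 1)]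
    refine le_trans ?_ (pow_mul_exp_sub_mul_le hβ (ν + 1) 1 e.2)
    exact mul_le_mul_of_nonneg_left ((abs_sigmoidDeriv₂_le_exp _).trans (Real.exp_le_exp.2
      (sub_le_sub_right (by linarith) _))) (by positivity)

lemma fermiOp_eq_energyOp {d : ℕ} (β μ : ℝ) :
    fermiOp β μ = ⇑(energyOp (fermi β (β * μ)) : OneParticle d →L[ℂ] OneParticle d) :=
  funext <| energyFunction_eq_energyOp fun e => by
    simp [fermi, Real.sigmoid_def, mul_sub, add_comm]

end FermiFunctions

section Onsager

variable {d : ℕ} {A : Type*} [CStarAlgebra A]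

lemma CARAlgebra.neg_secondQuantization (C : CARAlgebra d A)
    (c : Reservoir → Reservoir → (Fin d → ℕ) × (Fin d → ℕ) → ℂ) :
    -C.secondQuantization c = C.secondQuantization fun r s Q => -1 * c r s Q := by
  simp only [secondQuantization, hopSum_const_mul, neg_one_smul, Finset.sum_neg_distrib]

namespace FreeReservoirs

variable (S : FreeReservoirs d A)

lemma nontrivial (S : FreeReservoirs d A) : Nontrivial A := by
  have hω := S.equilibrium_spec (fun _ => 1) (fun _ => 0) fun _ => one_pos
  refine ⟨1, 0, fun h => ?_⟩
  simpa [h] using hω.unit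

lemma isQuasiFreeState_equilibrium {β μ : Reservoir → ℝ} (hβ : ∀ r, 0 < β r) :
    S.IsQuasiFreeState (fun r => energyOp (fermi (β r) (β r * μ r))) (S.equilibrium β μ) := by
  simpa only [fermiOp_eq_energyOp] using S.equilibrium_spec β μ hβ

lemma particleFlux_secondQuantization
    {c : Reservoir → Reservoir → (Fin d → ℕ) × (Fin d → ℕ) → ℂ} (hc : ∀ r s, Tame (c r s)) :
    S.particleFlux (S.secondQuantization c) = S.secondQuantization (particleFluxMatrix c) := by
  rw [particleFlux, (S.hasDerivAt_gauge_secondQuantization hc).deriv,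
    CARAlgebra.neg_secondQuantization]
  rfl

variable {w : ∀ N : ℕ, Kernel d N} {v : Kernel d 1}

lemma tendsto_particleCurrentAt (hd : 3 ≤ d) (hw : (w 1).HasFiniteNorm)
    {β μ : Reservoir → ℝ} (hβ : ∀ r, 0 < β r) :
    Tendsto (S.particleCurrentAt w 2 2 β μ) atTop (𝓝 (stationaryFlux (w 1).matrix
        (particleFluxMatrix (w 1).matrix) Reservoir.I
        (fermi (β Reservoir.I) (β Reservoir.I * μ Reservoir.I)) +
      netTransport hd hw.tame_matrix
        (fermi (β Reservoir.II) (β Reservoir.II * μ Reservoir.II)))) := by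
  have hW : S.interaction w 1 = S.secondQuantization (w 1).matrix :=
    S.quantize_eq_secondQuantization hw
  rw [← stationaryFlux_particle hd hw.tame_matrix, ← sum_reservoir fun r => stationaryFlux _ _ r
    (fermi (β r) (β r * μ r))]
  refine S.tendsto_expectationTerm hd hw.tame_matrix (o := particleFluxMatrix (w 1).matrix)
    (fun r s => ((hw.tame_matrix r s).const_mul _).const_mul _) hW ?_
    (S.isQuasiFreeState_equilibrium hβ)
  rw [hW, S.particleFlux_secondQuantization hw.tame_matrix]

lemma tendsto_energyCurrentAt (hd : 3 ≤ d) (hw : (w 1).HasFiniteNorm) (hv : v.HasFiniteNorm)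
    (h : HasDerivAt (fun s : ℝ => S.evol Reservoir.I s (S.interaction w 1)) (S.quantize v) 0)
    {β μ : Reservoir → ℝ} (hβ : ∀ r, 0 < β r) {m : Symbol} (hm : ∀ e : ℝ≥0, m e =
      ((e : ℝ) : ℂ) * fermi (β Reservoir.II) (β Reservoir.II * μ Reservoir.II) e) :
    Tendsto (S.energyCurrentAt w 2 2 β μ) atTop (𝓝 (stationaryFlux (w 1).matrix
        (fun r s Q => -1 * v.matrix r s Q) Reservoir.I
        (fermi (β Reservoir.I) (β Reservoir.I * μ Reservoir.I)) +
      netTransport hd hw.tame_matrix m)) := by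
  have := S.nontrivial
  have hW : S.interaction w 1 = S.secondQuantization (w 1).matrix :=
    S.quantize_eq_secondQuantization hw
  have hflux : S.energyFlux (S.interaction w 1) =
      S.secondQuantization fun r s Q => -1 * v.matrix r s Q := by
    rw [energyFlux, h.deriv, S.quantize_eq_secondQuantization hv,
      CARAlgebra.neg_secondQuantization]
  rw [hW, S.quantize_eq_secondQuantization hv] at h
  rw [← stationaryFlux_energy hd hw.tame_matrix hv.tame_matrix S h
    (m₂ := fermiMoment (hβ Reservoir.II) (β Reservoir.II * μ Reservoir.II) 2)
    hm (fun e => by simp [hm, thermalMoment, fermi, sq, mul_assoc]),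
    ← sum_reservoir fun r => stationaryFlux _ _ r (fermi (β r) (β r * μ r))]
  exact S.tendsto_expectationTerm hd hw.tame_matrix
    (fun r s => (hv.tame_matrix r s).const_mul _) hW hflux (S.isQuasiFreeState_equilibrium hβ)

lemma invTemp_pos {β Δβ : ℝ} (hβ : 0 < β) (h : Δβ < β) (r : Reservoir) : 0 < invTemp β Δβ r := by
  cases r
  exacts [hβ, sub_pos.2 h]

lemma invTemp_mul_chemPot_I {β : ℝ} (hβ : 0 < β) (ν Δβ Δν : ℝ) :
    invTemp β Δβ Reservoir.I * chemPot β ν Δβ Δν Reservoir.I = ν :=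
  mul_div_cancel₀ _ hβ.ne'

lemma invTemp_mul_chemPot_II {β Δβ : ℝ} (h : Δβ < β) (ν Δν : ℝ) :
    invTemp β Δβ Reservoir.II * chemPot β ν Δβ Δν Reservoir.II = ν - Δν :=
  mul_div_cancel₀ _ (sub_pos.2 h).ne'

lemma hasDerivAt_energyCurrent (hd : 3 ≤ d) (hw : (w 1).HasFiniteNorm) (hv : v.HasFiniteNorm)
    (h : HasDerivAt (fun s : ℝ => S.evol Reservoir.I s (S.interaction w 1)) (S.quantize v) 0)
    {β : ℝ} (hβ : 0 < β) (ν : ℝ) :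
    HasDerivAt (fun Δν : ℝ => S.energyCurrent w 2 2 (invTemp β 0) (chemPot β ν 0 Δν))
      (-netTransport hd hw.tame_matrix (energyFermiDeriv hβ ν)) 0 := by
  have hm (Δν : ℝ) (e : ℝ≥0) : fermiMoment hβ (ν - Δν) 1 e = ((e : ℝ) : ℂ) *
      fermi (invTemp β 0 Reservoir.II)
        (invTemp β 0 Reservoir.II * chemPot β ν 0 Δν Reservoir.II) e := by
    rw [invTemp_mul_chemPot_II hβ, fermiMoment_one_apply, invTemp, sub_zero]
  have hcurrent (Δν : ℝ) :=
    (S.tendsto_energyCurrentAt hd hw hv h (invTemp_pos hβ hβ) (hm Δν)).limUnder_eq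
  simp only [energyCurrent, hcurrent, invTemp_mul_chemPot_I hβ]
  rw [← map_neg]
  exact (hasDerivAt_clm_comp (netTransport hd hw.tame_matrix)
    (hasDerivAt_fermiMoment_one hβ ν)).const_add _

lemma hasDerivAt_particleCurrent (hd : 3 ≤ d) (hw : (w 1).HasFiniteNorm)
    {β : ℝ} (hβ : 0 < β) (ν : ℝ) :
    HasDerivAt (fun Δβ : ℝ => S.particleCurrent w 2 2 (invTemp β Δβ) (chemPot β ν Δβ 0))
      (netTransport hd hw.tame_matrix (energyFermiDeriv hβ ν)) 0 := by
  refine ((hasDerivAt_clm_comp (netTransport hd hw.tame_matrix)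
    (hasDerivAt_fermi hβ ν)).const_add (stationaryFlux (w 1).matrix
      (particleFluxMatrix (w 1).matrix) Reservoir.I (fermi β ν))).congr_of_eventuallyEq ?_
  filter_upwards [gt_mem_nhds hβ] with Δβ hΔβ
  rw [particleCurrent, (S.tendsto_particleCurrentAt hd hw (invTemp_pos hβ hΔβ)).limUnder_eq,
    invTemp_mul_chemPot_I hβ, invTemp_mul_chemPot_II hΔβ, sub_zero]
  rfl

end FreeReservoirs

end Onsager

end FermiJunction

end

theorem mainTheorem5_general {d : ℕ} (hd : 3 ≤ d) {A : Type*} [CStarAlgebra A]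
    (S : FermiJunction.FreeReservoirs d A)
    (w : ∀ N : ℕ, FermiJunction.Kernel d N) (hw : (w 1).HasFiniteNorm)
    (v : FermiJunction.Kernel d 1) (hv : v.HasFiniteNorm)
    (h : HasDerivAt (fun s : ℝ => S.evol FermiJunction.Reservoir.I s (S.interaction w 1))
      (S.quantize v) 0) :
    (∀ β μ : FermiJunction.Reservoir → ℝ, (∀ r, 0 < β r) →
      Tendsto (S.particleCurrentAt w 2 2 β μ) atTop (𝓝 (S.particleCurrent w 2 2 β μ)) ∧
      Tendsto (S.energyCurrentAt w 2 2 β μ) atTop (𝓝 (S.energyCurrent w 2 2 β μ))) ∧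
    ∀ β ν : ℝ, 0 < β →
      DifferentiableAt ℝ (fun Δν : ℝ => S.energyCurrent w 2 2
        (FermiJunction.invTemp β 0) (FermiJunction.chemPot β ν 0 Δν)) 0 ∧
      DifferentiableAt ℝ (fun Δβ : ℝ => S.particleCurrent w 2 2
        (FermiJunction.invTemp β Δβ) (FermiJunction.chemPot β ν Δβ 0)) 0 ∧
      deriv (fun Δν : ℝ => S.energyCurrent w 2 2
        (FermiJunction.invTemp β 0) (FermiJunction.chemPot β ν 0 Δν)) 0 =
      -deriv (fun Δβ : ℝ => S.particleCurrent w 2 2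
        (FermiJunction.invTemp β Δβ) (FermiJunction.chemPot β ν Δβ 0)) 0 := by
  refine ⟨fun β μ hβ => ⟨tendsto_nhds_limUnder ⟨_, S.tendsto_particleCurrentAt hd hw hβ⟩,
    tendsto_nhds_limUnder ⟨_, S.tendsto_energyCurrentAt hd hw hv h hβ
      (FermiJunction.fermiMoment_one_apply (hβ _) _)⟩⟩, fun β ν hβ => ?_⟩
  have hJ := S.hasDerivAt_particleCurrent hd hw hβ ν
  have hP := S.hasDerivAt_energyCurrent hd hw hv h hβ ν
  exact ⟨hP.differentiableAt, hJ.differentiableAt, hP.deriv.trans (congrArg Neg.neg hJ.deriv.symm)⟩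

theorem mainTheorem5 {d : ℕ} (hd : 3 ≤ d) {A : Type*} [CStarAlgebra A]
    (S : FermiJunction.FreeReservoirs d A)
    (w : ∀ N : ℕ, FermiJunction.Kernel d N)
    (hw : ∀ N : ℕ, 1 ≤ N → (w N).HasFiniteNorm)
    (hsa : ∀ N : ℕ, 1 ≤ N → IsSelfAdjoint (S.interaction w N))
    (henergy : ∀ N : ℕ, 1 ≤ N → ∃ v : FermiJunction.Kernel d N, v.HasFiniteNorm ∧
      HasDerivAt (fun s : ℝ => S.evol FermiJunction.Reservoir.I s (S.interaction w N))
        (S.quantize v) 0) :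
    (∀ β μ : FermiJunction.Reservoir → ℝ, (∀ r, 0 < β r) →
      Tendsto (S.particleCurrentAt w 2 2 β μ) atTop (𝓝 (S.particleCurrent w 2 2 β μ)) ∧
      Tendsto (S.energyCurrentAt w 2 2 β μ) atTop (𝓝 (S.energyCurrent w 2 2 β μ))) ∧
    ∀ β ν : ℝ, 0 < β →
      DifferentiableAt ℝ (fun Δν : ℝ => S.energyCurrent w 2 2
        (FermiJunction.invTemp β 0) (FermiJunction.chemPot β ν 0 Δν)) 0 ∧
      DifferentiableAt ℝ (fun Δβ : ℝ => S.particleCurrent w 2 2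
        (FermiJunction.invTemp β Δβ) (FermiJunction.chemPot β ν Δβ 0)) 0 ∧
      deriv (fun Δν : ℝ => S.energyCurrent w 2 2
        (FermiJunction.invTemp β 0) (FermiJunction.chemPot β ν 0 Δν)) 0 =
      -deriv (fun Δβ : ℝ => S.particleCurrent w 2 2
        (FermiJunction.invTemp β Δβ) (FermiJunction.chemPot β ν Δβ 0)) 0 := by
  obtain ⟨v, hv, h⟩ := henergy 1 le_rfl
  exact mainTheorem5_general hd S w (hw 1 le_rfl) v hv h
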